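/- Let $d\ge 1$, let $X\subseteq\mathbb R^d$ have non-empty interior, and let $K(x,x')=k(x-x')$ for $x,x'\in X$, where $k:\mathbb R^d\to\mathbb R$ has a finite Borel spectral measure $\alpha$ on $\mathbb R^d$, that is, $$k(x)=\int_{\mathbb R^d}e^{i(t_1x_1+\dots+t_dx_d)}\,\alpha(dt)\qquad(x\in\mathbb R^d).$$ Let $H(K)$ be the real reproducing kernel Hilbert space on $X$ with kernel $K$, and let $\alpha_j(B)=\alpha(\{t: t_j\in B\})$ be the $j$-th marginal of $\alpha$. Call a Borel measure $\mu$ on $\mathbb R$ Hamburger-determinate if all its moments are finite and every Borel measure on $\mathbb R$ with the same (finite) moments $\int t^n\mu(dt)$, $n=0,1,2,\dots$, equals $\mu$. Assume that $\alpha(\{0\})=0$ and that, for some $i\in\{1,\dots,d\}$, the measures $t^{2m}\alpha_i(dt)$ are Hamburger-determinate for all $m=0,1,2,\dots$. Then: 1. If $\alpha_i(\{0\})=0$ or $X=\mathbb R^d$, then $H(K)$ contains no (restriction to $X$ of a) non-zero polynomial in $d$ variables with real coefficients. 2. In any case, $H(K)$ contains no (restriction to $X$ of a) polynomial that has positive degree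 in the variable $x_i$. -/

import Mathlib

open MeasureTheory

/-- The Hamburger moment problem for `μ` is determinate: all moments of `μ` are finite, and `μ` is
the only (positive Borel) measure on the line with these moments. Integrability for `n = 0` says
that the measure is finite. The property does not change when `μ` is multiplied by a positive
constant. -/
def HamburgerDeterminate (μ : Measure ℝ) : Prop :=
  (∀ n : ℕ, Integrable (fun t : ℝ => t ^ n) μ) ∧
    ∀ ν : Measure ℝ,
      (∀ n : ℕ, Integrable (fun t : ℝ => t ^ n) ν ∧ ∫ t, t ^ n ∂ν = ∫ t, t ^ n ∂μ) → ν = μ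

/-- `α` is the spectral measure of `k`, that is `k x = ∫ exp (i ⟨t, x⟩) α(dt)` for all `x`. -/
def IsSpectralMeasure {d : ℕ} (α : Measure (EuclideanSpace ℝ (Fin d)))
    (k : EuclideanSpace ℝ (Fin d) → ℝ) : Prop :=
  IsFiniteMeasure α ∧
    ∀ x, (k x : ℂ) = ∫ t : EuclideanSpace ℝ (Fin d),
      Complex.exp (Complex.I * ((∑ j, t j * x j : ℝ) : ℂ)) ∂α

/-- The `i`-th marginal of a measure on `ℝ^d`. -/
noncomputable def marginal {d : ℕ} (α : Measure (EuclideanSpace ℝ (Fin d))) (i : Fin d) :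
    Measure ℝ :=
  α.map (fun t => t i)

/-- The measure `t ^ (2 m) μ(dt)`. -/
noncomputable def evenPowerWeighted (μ : Measure ℝ) (m : ℕ) : Measure ℝ :=
  μ.withDensity (fun t => ENNReal.ofReal (t ^ (2 * m)))

/-- `H` is the reproducing kernel Hilbert space on `X` of the kernel `K(x, y) = k (x - y)`. -/
def IsRKHSOfTranslationKernel {d : ℕ} (X : Set (EuclideanSpace ℝ (Fin d)))
    (k : EuclideanSpace ℝ (Fin d) → ℝ) (H : Type*) [NormedAddCommGroup H]
    [InnerProductSpace ℝ H] [CompleteSpace H] [RKHS ℝ H X ℝ] : Prop :=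
  ∀ x y : X, RKHS.kernel H x y 1 = k ((x : EuclideanSpace ℝ (Fin d)) - y)

/-- The restriction of the polynomial `p` to `X` is an element of `H`. -/
def PolynomialMem {d : ℕ} {X : Set (EuclideanSpace ℝ (Fin d))} (H : Type*)
    [NormedAddCommGroup H] [InnerProductSpace ℝ H] [RKHS ℝ H X ℝ]
    (p : MvPolynomial (Fin d) ℝ) : Prop :=
  ∃ f : H, ∀ x : X, f x = MvPolynomial.eval (fun j => (x : EuclideanSpace ℝ (Fin d)) j) p

/-! An element of `H` has the form x ↦ ∫ g(t) exp(i⟨t,x⟩) α(dt) with g ∈ L²(α), because sending the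
kernel function at x to the plane wave at x preserves inner products (`exists_spectral_density`). If
it is a polynomial near x, differentiating along the i-th axis beyond the degree shows that G = g ·
`planeWave x` is orthogonal to all high powers of t_i.

The crux is that determinacy then forces G to have integral zero off the hyperplane t_i = 0
(`setIntegral_ne_zero_eq_zero`). For determinate μ, Riesz extension yields polynomials p ≤ 1/(1+t²)
with almost the same integral; factoring 1 − (1+t²)p = |s|² gives s with |s(i)| ≥ 1 and ∫
|s|²/(1+t²) dμ arbitrarily small. With μ = t^(2m) α_i, this shows that orthogonality to all
t_i^(m+n) survives division by t_i − i. It therefore survives multiplication by the algebra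
generated by 1/(1+t²) and t/(1+t²), which separates points. So the pushforward of G t_i^m α
vanishes, and t_i^m can be divided out away from 0.

Thus near x the polynomial is an integral over t_i = 0 only, which does not see x_i and vanishes if
α_i has no atom at 0. If X is the whole space, the polynomial is bounded, hence constant, and
averaging translates of the transform isolates the mass at the origin, which is zero
(`eq_zero_of_integral_planeWave_eq_const`). -/

/-! ### Non-negative polynomials on the line -/

open Polynomial in
-- Real roots are double and non-real roots come in conjugate pairs, so each root splits off a
-- factor u · conj u whose quotient is again non-negative; induct on the degree.
theorem Polynomial.exists_map_eq_mul_conj_of_nonneg (P : ℝ[X]) (hP : ∀ t : ℝ, 0 ≤ P.eval t) :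
    ∃ s : ℂ[X], P.map (algebraMap ℝ ℂ) = s * s.map (starRingEnd ℂ) := by
  induction h : P.natDegree using Nat.strong_induction_on generalizing P with
  | _ n ih =>
  rcases Nat.eq_zero_or_pos n with hn | hn
  · obtain ⟨c, rfl⟩ := natDegree_eq_zero.1 (h.trans hn)
    have hc : 0 ≤ c := by simpa using hP 0
    refine ⟨C ((√c : ℝ) : ℂ), ?_⟩
    rw [map_C, map_C, ← C_mul, Complex.conj_ofReal, ← Complex.ofReal_mul, Real.mul_self_sqrt hc]
    simp
  have hP0 : P ≠ 0 := by rintro rfl; simp at h; omega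
  obtain ⟨z, hz⟩ := IsAlgClosed.exists_aeval_eq_zero ℂ P
    (by rw [Polynomial.degree_eq_natDegree hP0, h]; exact_mod_cast hn.ne')
  by_cases him : z.im = 0
  · obtain ⟨r, rfl⟩ : ∃ r : ℝ, z = r := ⟨z.re, by apply Complex.ext <;> simp [him]⟩
    have hr : P.eval r = 0 := by
      have := Polynomial.aeval_algebraMap_apply ℂ r P
      rw [Complex.coe_algebraMap, hz] at this
      simpa [Polynomial.coe_aeval_eq_eval] using this.symm
    obtain ⟨Q, rfl⟩ := dvd_iff_isRoot.2 hr
    -- The root `r` is a minimum, so the derivative, which equals `Q.eval r` there, vanishes: the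
    -- root is at least double.
    have hmin : IsLocalMin (fun t => ((X - C r) * Q).eval t) r :=
      Filter.Eventually.of_forall fun t => by simpa [hr] using hP t
    have hd := hmin.hasDerivAt_eq_zero (Polynomial.hasDerivAt _ r)
    have hQ : Q.eval r = 0 := by simpa [derivative_mul] using hd
    obtain ⟨R, rfl⟩ := dvd_iff_isRoot.2 hQ
    have hR : ∀ t : ℝ, 0 ≤ R.eval t := by
      have hcl : IsClosed {t : ℝ | 0 ≤ R.eval t} := isClosed_le continuous_const R.continuous
      have hsub : ({r}ᶜ : Set ℝ) ⊆ {t : ℝ | 0 ≤ R.eval t} := fun t ht => by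
        have h1 := hP t
        have h2 : 0 < (t - r) ^ 2 := by
          have : t - r ≠ 0 := sub_ne_zero.2 ht
          positivity
        rw [← mul_assoc, ← sq, eval_mul, eval_pow, eval_sub, eval_X, eval_C] at h1
        exact nonneg_of_mul_nonneg_right h1 h2
      intro t
      exact hcl.closure_subset_iff.2 hsub ((dense_compl_singleton r) t)
    have hR0 : R ≠ 0 := by rintro rfl; simp at hP0
    obtain ⟨s, hs⟩ := ih R.natDegree (by
      rw [← h, natDegree_mul (X_sub_C_ne_zero r) (mul_ne_zero (X_sub_C_ne_zero r) hR0),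
        natDegree_mul (X_sub_C_ne_zero r) hR0, natDegree_X_sub_C]; omega) R hR rfl
    refine ⟨(X - C (r : ℂ)) * s, ?_⟩
    simp only [Polynomial.map_mul, hs, Polynomial.map_sub, map_X, map_C, Complex.coe_algebraMap,
      Complex.conj_ofReal]
    ring
  · obtain ⟨R, rfl⟩ := quadratic_dvd_of_aeval_eq_zero_im_ne_zero P hz him
    have hq : ∀ t : ℝ, 0 < (X ^ 2 - C (2 * z.re) * X + C (‖z‖ ^ 2)).eval t := fun t => by
      have h1 : (X ^ 2 - C (2 * z.re) * X + C (‖z‖ ^ 2)).eval t = (t - z.re) ^ 2 + z.im ^ 2 := by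
        simp [Complex.sq_norm, Complex.normSq_apply]; ring
      rw [h1]; positivity
    have hR : ∀ t : ℝ, 0 ≤ R.eval t := fun t => by
      have := hP t
      rw [eval_mul] at this
      exact nonneg_of_mul_nonneg_right this (hq t)
    have hR0 : R ≠ 0 := by rintro rfl; simp at hP0
    have hdeg : (X ^ 2 - C (2 * z.re) * X + C (‖z‖ ^ 2)).natDegree = 2 := by compute_degree!
    obtain ⟨s, hs⟩ := ih R.natDegree (by
      rw [← h, natDegree_mul (fun h0 => (hq 0).ne' (by rw [h0, eval_zero])) hR0, hdeg]; omega) R hR rfl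
    refine ⟨(X - C z) * s, ?_⟩
    have h1 : (X ^ 2 - C (2 * z.re) * X + C (‖z‖ ^ 2)).map (algebraMap ℝ ℂ)
        = (X - C z) * (X - C (starRingEnd ℂ z)) := by
      have e1 : C ((2 * z.re : ℝ) : ℂ) = C z + C (starRingEnd ℂ z) := by
        rw [← C_add, Complex.add_conj]
      have e2 : C ((‖z‖ ^ 2 : ℝ) : ℂ) = C z * C (starRingEnd ℂ z) := by
        rw [← C_mul, Complex.mul_conj, Complex.normSq_eq_norm_sq]
      simp only [Polynomial.map_add, Polynomial.map_sub, Polynomial.map_mul, Polynomial.map_pow,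
        map_X, map_C, Complex.coe_algebraMap, e1, e2]
      ring
    simp only [Polynomial.map_mul, hs, h1, Polynomial.map_sub, map_X, map_C]
    ring

/-! ### Positive functionals on polynomially bounded functions -/

open Filter Topology

/-- The functions on the line that are bounded by a polynomial. -/
def polynomiallyBounded : Submodule ℝ (ℝ → ℝ) where
  carrier := {f | ∃ P : Polynomial ℝ, ∀ t, |f t| ≤ P.eval t}
  add_mem' := by
    rintro f g ⟨P, hP⟩ ⟨Q, hQ⟩
    exact ⟨P + Q, fun t => by
      rw [Polynomial.eval_add]
      exact (abs_add_le _ _).trans (add_le_add (hP t) (hQ t))⟩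
  zero_mem' := ⟨0, by simp⟩
  smul_mem' := by
    rintro c f ⟨P, hP⟩
    refine ⟨Polynomial.C |c| * P, fun t => ?_⟩
    simpa [abs_mul] using mul_le_mul_of_nonneg_left (hP t) (abs_nonneg c)

namespace polynomiallyBounded

theorem mem_of_abs_le {f g : ℝ → ℝ} (hg : g ∈ polynomiallyBounded) (h : ∀ t, |f t| ≤ |g t|) :
    f ∈ polynomiallyBounded := by
  obtain ⟨P, hP⟩ := hg
  exact ⟨P, fun t => (h t).trans (hP t)⟩

theorem mul_mem {f g : ℝ → ℝ} (hf : f ∈ polynomiallyBounded) (hg : g ∈ polynomiallyBounded) :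
    (fun t => f t * g t) ∈ polynomiallyBounded := by
  obtain ⟨P, hP⟩ := hf
  obtain ⟨Q, hQ⟩ := hg
  refine ⟨P * Q, fun t => ?_⟩
  rw [abs_mul, Polynomial.eval_mul]
  exact mul_le_mul (hP t) (hQ t) (abs_nonneg _) ((abs_nonneg _).trans (hP t))

theorem const_mem (c : ℝ) : (fun _ => c) ∈ polynomiallyBounded :=
  ⟨Polynomial.C |c|, by simp⟩

theorem id_mem : (fun t => t) ∈ polynomiallyBounded :=
  ⟨1 + Polynomial.X ^ 2, fun t => by
    simp only [Polynomial.eval_add, Polynomial.eval_one, Polynomial.eval_pow, Polynomial.eval_X]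
    exact abs_le.2 ⟨by nlinarith [sq_nonneg (t + 1)], by nlinarith [sq_nonneg (t - 1)]⟩⟩

theorem eval_mem (P : Polynomial ℝ) : (fun t => P.eval t) ∈ polynomiallyBounded := by
  induction P using Polynomial.induction_on' with
  | add p q hp hq =>
    simp only [Polynomial.eval_add]
    exact polynomiallyBounded.add_mem hp hq
  | monomial n a =>
    induction n with
    | zero => simpa using const_mem a
    | succ n ih => simpa [pow_succ, mul_assoc] using mul_mem ih id_mem

theorem mem_of_bounded {f : ℝ → ℝ} (C : ℝ) (h : ∀ t, |f t| ≤ C) : f ∈ polynomiallyBounded :=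
  mem_of_abs_le (const_mem C) fun t => (h t).trans (le_abs_self C)

end polynomiallyBounded

/-- A continuous cutoff equal to `1` on `[-R, R]` and to `0` outside `[-(R + 1), R + 1]`. -/
def cutoff (R t : ℝ) : ℝ := max 0 (min 1 (R + 1 - |t|))

theorem cutoff_nonneg (R t : ℝ) : 0 ≤ cutoff R t := le_max_left _ _

theorem cutoff_le_one (R t : ℝ) : cutoff R t ≤ 1 := max_le zero_le_one (min_le_left _ _)

theorem cutoff_eq_one {R t : ℝ} (h : |t| ≤ R) : cutoff R t = 1 := by
  rw [cutoff, min_eq_left (by linarith), max_eq_right zero_le_one]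

theorem cutoff_eq_zero {R t : ℝ} (h : R + 1 ≤ |t|) : cutoff R t = 0 :=
  max_eq_left ((min_le_right _ _).trans (by linarith))

theorem continuous_cutoff (R : ℝ) : Continuous (cutoff R) := by
  unfold cutoff; fun_prop

/-- This quantifies truncation by a polynomial weight, so that positivity alone controls the tail of
a functional. -/
theorem one_sub_cutoff_le {R : ℝ} (hR : 0 < R) (t : ℝ) : 1 - cutoff R t ≤ t ^ 2 / R ^ 2 := by
  rcases le_total |t| R with h | h
  · rw [cutoff_eq_one h, sub_self]; positivity
  · have : 1 ≤ t ^ 2 / R ^ 2 := by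
      rw [one_le_div (by positivity), ← sq_abs t]
      gcongr
    linarith [cutoff_nonneg R t]

theorem hasCompactSupport_cutoff_mul (R : ℝ) (f : ℝ → ℝ) :
    HasCompactSupport (fun t => cutoff R t * f t) := by
  refine HasCompactSupport.of_support_subset_isCompact (isCompact_Icc (a := -(R + 1)) (b := R + 1))
    fun t ht => ?_
  by_contra hcon
  refine ht ?_
  have : R + 1 ≤ |t| := by
    by_contra! h
    exact hcon (abs_le.1 h.le)
  simp [cutoff_eq_zero this]

theorem tendsto_cutoff (t : ℝ) : Tendsto (fun n : ℕ => cutoff n t) atTop (𝓝 1) := by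
  refine tendsto_const_nhds.congr' ?_
  filter_upwards [eventually_ge_atTop ⌈|t|⌉₊] with n hn
  exact (cutoff_eq_one ((Nat.le_ceil _).trans (by exact_mod_cast hn))).symm

/-- A positive linear functional on the polynomially bounded functions is given on the continuous
ones by integration against a measure. -/
theorem exists_measure_of_positive (Λ : polynomiallyBounded →ₗ[ℝ] ℝ)
    (hΛ : ∀ f : polynomiallyBounded, (∀ t, 0 ≤ (f : ℝ → ℝ) t) → 0 ≤ Λ f) :
    ∃ ν : Measure ℝ, ∀ f : polynomiallyBounded, Continuous (f : ℝ → ℝ) →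
      Integrable (f : ℝ → ℝ) ν ∧ ∫ t, (f : ℝ → ℝ) t ∂ν = Λ f := by
  have hmono : ∀ f g : polynomiallyBounded, (∀ t, (f : ℝ → ℝ) t ≤ (g : ℝ → ℝ) t) → Λ f ≤ Λ g :=
    fun f g h => by
      have := hΛ (g - f) fun t => by simpa using h t
      rw [map_sub] at this; linarith
  have hmem : ∀ φ : CompactlySupportedContinuousMap ℝ ℝ, (φ : ℝ → ℝ) ∈ polynomiallyBounded := by
    intro φ
    obtain ⟨C, hC⟩ := φ.hasCompactSupport.exists_bound_of_continuous φ.continuous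
    exact polynomiallyBounded.mem_of_bounded C hC
  let Λ₀ : CompactlySupportedContinuousMap ℝ ℝ →ₗ[ℝ] ℝ :=
    { toFun := fun φ => Λ ⟨φ, hmem φ⟩
      map_add' := fun φ ψ => by rw [← map_add]; rfl
      map_smul' := fun c φ => by rw [← map_smul]; rfl }
  let Λ₁ : CompactlySupportedContinuousMap ℝ ℝ →ₚ[ℝ] ℝ :=
    PositiveLinearMap.mk₀ Λ₀ fun φ hφ => hΛ _ fun t => hφ t
  let ν := RealRMK.rieszMeasure Λ₁
  have hν : ∀ φ : CompactlySupportedContinuousMap ℝ ℝ, ∫ t, φ t ∂ν = Λ ⟨φ, hmem φ⟩ :=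
    fun φ => RealRMK.integral_rieszMeasure Λ₁ φ
  refine ⟨ν, fun f hf => ?_⟩
  have hcut : ∀ (g : polynomiallyBounded), Continuous (g : ℝ → ℝ) → ∀ n : ℕ,
      ∃ h : (fun t => cutoff n t * (g : ℝ → ℝ) t) ∈ polynomiallyBounded,
        Integrable (fun t => cutoff n t * (g : ℝ → ℝ) t) ν ∧
        ∫ t, cutoff n t * (g : ℝ → ℝ) t ∂ν = Λ ⟨_, h⟩ := fun g hg n => by
    let φ : CompactlySupportedContinuousMap ℝ ℝ :=
      ⟨⟨fun t => cutoff n t * (g : ℝ → ℝ) t, (continuous_cutoff n).mul hg⟩,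
        hasCompactSupport_cutoff_mul n _⟩
    exact ⟨hmem φ, φ.continuous.integrable_of_hasCompactSupport φ.hasCompactSupport, hν φ⟩
  have habs : (fun t => |(f : ℝ → ℝ) t|) ∈ polynomiallyBounded :=
    polynomiallyBounded.mem_of_abs_le f.2 fun t => by simp
  have hint : Integrable (f : ℝ → ℝ) ν := by
    have hcov : AECover ν atTop (fun n : ℕ => Set.Icc (-(n : ℝ)) n) :=
      aecover_Icc (tendsto_neg_atTop_atBot.comp tendsto_natCast_atTop_atTop)
        tendsto_natCast_atTop_atTop
    refine hcov.integrable_of_integral_norm_bounded (Λ ⟨_, habs⟩)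
      (fun n => hf.continuousOn.integrableOn_compact isCompact_Icc) (Eventually.of_forall fun n => ?_)
    obtain ⟨h1, h2, h3⟩ := hcut ⟨_, habs⟩ hf.abs n
    calc ∫ t in Set.Icc (-(n : ℝ)) n, ‖(f : ℝ → ℝ) t‖ ∂ν
        = ∫ t in Set.Icc (-(n : ℝ)) n, cutoff n t * |(f : ℝ → ℝ) t| ∂ν := by
          refine setIntegral_congr_fun measurableSet_Icc fun t ht => ?_
          simp only [cutoff_eq_one (abs_le.2 ht), one_mul, Real.norm_eq_abs]
      _ ≤ ∫ t, cutoff n t * |(f : ℝ → ℝ) t| ∂ν :=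
          setIntegral_le_integral h2 (Eventually.of_forall fun t =>
            mul_nonneg (cutoff_nonneg _ _) (abs_nonneg _))
      _ = _ := h3
      _ ≤ _ := hmono _ _ fun t => mul_le_of_le_one_left (abs_nonneg _) (cutoff_le_one _ _)
  refine ⟨hint, ?_⟩
  -- No continuity of `Λ` is available; the truncation error is dominated by n⁻² · t²|f|, which
  -- still lies in the domain of `Λ`.
  have hsq : (fun t => t ^ 2 * |(f : ℝ → ℝ) t|) ∈ polynomiallyBounded := by
    have : (fun t : ℝ => t ^ 2) ∈ polynomiallyBounded := by
      simpa using polynomiallyBounded.eval_mem (Polynomial.X ^ (2 : ℕ))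
    exact polynomiallyBounded.mul_mem this habs
  have lim1 : Tendsto (fun n : ℕ => ∫ t, cutoff n t * (f : ℝ → ℝ) t ∂ν) atTop
      (𝓝 (∫ t, (f : ℝ → ℝ) t ∂ν)) := by
    refine tendsto_integral_of_dominated_convergence (fun t => |(f : ℝ → ℝ) t|)
      (fun n => ((continuous_cutoff n).mul hf).aestronglyMeasurable) hint.abs
      (fun n => Eventually.of_forall fun t => ?_) (Eventually.of_forall fun t => ?_)
    · rw [norm_mul, Real.norm_eq_abs, Real.norm_eq_abs, abs_of_nonneg (cutoff_nonneg _ _)]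
      exact mul_le_of_le_one_left (abs_nonneg _) (cutoff_le_one _ _)
    · simpa using (tendsto_cutoff t).mul_const ((f : ℝ → ℝ) t)
  have lim2 : Tendsto (fun n : ℕ => ∫ t, cutoff n t * (f : ℝ → ℝ) t ∂ν) atTop (𝓝 (Λ f)) := by
    have hbd : ∀ n : ℕ, 0 < n → |∫ t, cutoff n t * (f : ℝ → ℝ) t ∂ν - Λ f|
        ≤ Λ ⟨_, hsq⟩ / (n : ℝ) ^ 2 := fun n hn => by
      obtain ⟨h1, -, h3⟩ := hcut f hf n
      have hn' : (0 : ℝ) < n := by exact_mod_cast hn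
      rw [h3, ← map_sub]
      have key : ∀ t, |cutoff n t * (f : ℝ → ℝ) t - (f : ℝ → ℝ) t|
          ≤ ((n : ℝ) ^ 2)⁻¹ * (t ^ 2 * |(f : ℝ → ℝ) t|) := fun t => by
        rw [← sub_one_mul, abs_mul, ← mul_assoc]
        gcongr
        rw [abs_sub_comm, abs_of_nonneg (sub_nonneg.2 (cutoff_le_one _ _)), mul_comm,
          ← div_eq_mul_inv]
        exact one_sub_cutoff_le hn' t
      rw [div_eq_inv_mul, ← smul_eq_mul, ← map_smul]
      refine abs_le.2 ⟨?_, hmono _ _ fun t => (abs_le.1 (key t)).2⟩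
      rw [← map_neg]
      exact hmono _ _ fun t => (abs_le.1 (key t)).1
    rw [tendsto_iff_norm_sub_tendsto_zero]
    refine squeeze_zero' (Eventually.of_forall fun n => norm_nonneg _) ?_
      (tendsto_const_nhds.div_atTop ((tendsto_pow_atTop (two_ne_zero)).comp
        tendsto_natCast_atTop_atTop) : Tendsto (fun n : ℕ => Λ ⟨_, hsq⟩ / (n : ℝ) ^ 2) atTop (𝓝 0))
    filter_upwards [eventually_gt_atTop 0] with n hn using hbd n hn
  exact tendsto_nhds_unique lim1 lim2

/-! ### Determinacy and the extremal problem -/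

theorem HamburgerDeterminate.integrable_eval {μ : Measure ℝ} (hμ : HamburgerDeterminate μ)
    (P : Polynomial ℝ) : Integrable (fun t => P.eval t) μ := by
  induction P using Polynomial.induction_on' with
  | add p q hp hq =>
    simp only [Polynomial.eval_add]
    exact hp.add hq
  | monomial n a => simpa using (hμ.1 n).const_mul a

theorem HamburgerDeterminate.isFiniteMeasure {μ : Measure ℝ} (hμ : HamburgerDeterminate μ) :
    IsFiniteMeasure μ := by
  have := hμ.1 0
  simp only [pow_zero] at this
  exact (integrable_const_iff_isFiniteMeasure one_ne_zero).1 this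

/-- Bounded continuous functions have polynomial minorants with almost the same integral, if the
measure is determinate. -/
theorem HamburgerDeterminate.exists_polynomial_minorant {μ : Measure ℝ}
    (hμ : HamburgerDeterminate μ) {f : ℝ → ℝ} (hf : Continuous f) (hf0 : ∀ t, 0 ≤ f t)
    (hf1 : ∀ t, f t ≤ 1) {ε : ℝ} (hε : 0 < ε) :
    ∃ p : Polynomial ℝ, (∀ t, p.eval t ≤ f t) ∧ ∫ t, f t ∂μ - ∫ t, p.eval t ∂μ < ε := by
  by_contra! hcon
  have := hμ.isFiniteMeasure
  have hpos : 0 < ∫ t, f t ∂μ := by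
    have := hcon 0 (by simpa using hf0)
    simp at this; linarith
  have hL1 : 0 < μ.real Set.univ := by
    rcases (measureReal_nonneg (μ := μ) (s := Set.univ)).eq_or_lt with h | h
    · have : μ = 0 := by
        rw [eq_comm, measureReal_eq_zero_iff] at h
        exact Measure.measure_univ_eq_zero.1 h
      simp [this] at hpos
    · exact h
  -- The constant with integral ∫f − ε, the largest value that the contrary hypothesis allows to a
  -- polynomial minorant.
  set κ : ℝ := (∫ t, f t ∂μ - ε) / μ.real Set.univ with hκ
  have hκ' : κ * μ.real Set.univ = ∫ t, f t ∂μ - ε := div_mul_cancel₀ _ hL1.ne'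
  have hfmem : f ∈ polynomiallyBounded := polynomiallyBounded.mem_of_bounded 1 fun t => by
    rw [abs_of_nonneg (hf0 t)]; exact hf1 t
  -- The multiples of κ − f and everything above them. An extension positive on this cone gives `f`
  -- an integral at most ∫f − ε, whereas `a = 0` provides ordinary positivity.
  let cone : PointedCone ℝ polynomiallyBounded :=
    { carrier := {h | ∃ a : ℝ, 0 ≤ a ∧ ∀ t, a * (κ - f t) ≤ (h : ℝ → ℝ) t}
      add_mem' := by
        rintro g h ⟨a, ha, hg⟩ ⟨b, hb, hh⟩
        refine ⟨a + b, add_nonneg ha hb, fun t => ?_⟩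
        rw [add_mul]
        exact add_le_add (hg t) (hh t)
      zero_mem' := ⟨0, le_rfl, by simp⟩
      smul_mem' := by
        rintro ⟨c, hc⟩ g ⟨a, ha, hg⟩
        refine ⟨c * a, mul_nonneg hc ha, fun t => ?_⟩
        rw [mul_assoc]
        exact mul_le_mul_of_nonneg_left (hg t) hc }
  let dom : Submodule ℝ polynomiallyBounded :=
    { carrier := {h | ∃ P : Polynomial ℝ, ∀ t, (h : ℝ → ℝ) t = P.eval t}
      add_mem' := by
        rintro g h ⟨P, hP⟩ ⟨Q, hQ⟩
        exact ⟨P + Q, fun t => by simp [hP, hQ]⟩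
      zero_mem' := ⟨0, by simp⟩
      smul_mem' := by
        rintro c g ⟨P, hP⟩
        exact ⟨Polynomial.C c * P, fun t => by simp [hP]⟩ }
  have hdomint : ∀ h : dom, Integrable ((h : polynomiallyBounded) : ℝ → ℝ) μ := by
    rintro ⟨h, P, hP⟩
    exact (hμ.integrable_eval P).congr (Eventually.of_forall fun t => (hP t).symm)
  let L : polynomiallyBounded →ₗ.[ℝ] ℝ :=
    { domain := dom
      toFun :=
        { toFun := fun h => ∫ t, ((h : polynomiallyBounded) : ℝ → ℝ) t ∂μ
          map_add' := fun g h => integral_add (hdomint g) (hdomint h)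
          map_smul' := fun c g => integral_const_mul c _ } }
  obtain ⟨Λ, hΛ1, hΛ2⟩ := riesz_extension cone L
    (by
      rintro ⟨h, P, hP⟩ ⟨a, ha, hh⟩
      change 0 ≤ ∫ t, (h : ℝ → ℝ) t ∂μ
      simp only [hP] at hh ⊢
      rcases ha.eq_or_lt with rfl | ha
      · exact integral_nonneg fun t => by simpa using hh t
      -- Dividing P ≥ a(κ − f) by `a` makes κ − P/a a minorant of `f`; the choice of κ turns the
      -- bound on its integral into ∫P ≥ 0.
      · have h1 := hcon (Polynomial.C κ - Polynomial.C a⁻¹ * P) fun t => by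
          have : κ - f t ≤ a⁻¹ * P.eval t := by
            rw [← div_eq_inv_mul, le_div_iff₀ ha, mul_comm]; exact hh t
          simp only [Polynomial.eval_sub, Polynomial.eval_mul, Polynomial.eval_C]
          linarith
        simp only [Polynomial.eval_sub, Polynomial.eval_mul, Polynomial.eval_C] at h1
        rw [integral_sub (integrable_const _) ((hμ.integrable_eval P).const_mul _),
          integral_const, integral_const_mul, smul_eq_mul, mul_comm _ κ, hκ'] at h1
        have h2 : 0 ≤ a⁻¹ * ∫ t, P.eval t ∂μ := by linarith
        exact nonneg_of_mul_nonneg_right h2 (inv_pos.2 ha))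
    (by
      rintro ⟨h, P, hP⟩
      refine ⟨⟨⟨_, polynomiallyBounded.eval_mem P⟩, P, fun t => rfl⟩, 0, le_rfl, fun t => ?_⟩
      have := (abs_le.1 (hP t)).1
      simp only [zero_mul, Submodule.coe_add, Pi.add_apply]
      linarith)
  obtain ⟨ν, hν⟩ := exists_measure_of_positive Λ fun h hh =>
    hΛ2 h ⟨0, le_rfl, fun t => by simpa using hh t⟩
  -- Determinacy enters here: the extension cannot differ from integration against `μ`, which
  -- contradicts the smaller value at `f`.
  have hνμ : ν = μ := hμ.2 ν fun n => by
    have hn : (fun t : ℝ => t ^ n) ∈ polynomiallyBounded := by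
      simpa using polynomiallyBounded.eval_mem (Polynomial.X ^ n)
    obtain ⟨h1, h2⟩ := hν ⟨_, hn⟩ (continuous_pow n)
    exact ⟨h1, h2.trans (hΛ1 ⟨⟨_, hn⟩, Polynomial.X ^ n, by simp⟩)⟩
  have hΛf : Λ ⟨f, hfmem⟩ = ∫ t, f t ∂μ := by rw [← (hν ⟨f, hfmem⟩ hf).2, hνμ]
  have hcmem := polynomiallyBounded.const_mem κ
  have hΛκ : Λ ⟨_, hcmem⟩ = ∫ t, f t ∂μ - ε := by
    rw [hΛ1 ⟨⟨_, hcmem⟩, Polynomial.C κ, by simp⟩]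
    change ∫ t, κ ∂μ = _
    rw [integral_const, smul_eq_mul, mul_comm, hκ']
  have := hΛ2 (⟨_, hcmem⟩ - ⟨f, hfmem⟩) ⟨1, zero_le_one, fun t => by simp⟩
  rw [map_sub, hΛf, hΛκ] at this
  linarith

open Polynomial in
/-- The extremal problem at `i` for a determinate measure has the value `0`. -/
theorem HamburgerDeterminate.exists_polynomial_integral_lt {μ : Measure ℝ}
    (hμ : HamburgerDeterminate μ) {ε : ℝ} (hε : 0 < ε) :
    ∃ s : ℂ[X], 1 ≤ ‖s.eval Complex.I‖ ∧
      Integrable (fun t : ℝ => ‖s.eval (t : ℂ)‖ ^ 2 / (1 + t ^ 2)) μ ∧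
      ∫ t : ℝ, ‖s.eval (t : ℂ)‖ ^ 2 / (1 + t ^ 2) ∂μ < ε := by
  have hne : ∀ t : ℝ, 1 + t ^ 2 ≠ 0 := fun t => by positivity
  have := hμ.isFiniteMeasure
  have hcont : Continuous fun t : ℝ => (1 + t ^ 2)⁻¹ := by fun_prop (disch := exact hne _)
  have hle : ∀ t : ℝ, (1 + t ^ 2)⁻¹ ≤ 1 := fun t => inv_le_one_of_one_le₀ (by nlinarith [sq_nonneg t])
  have h0 : ∀ t : ℝ, 0 ≤ (1 + t ^ 2)⁻¹ := fun t => by positivity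
  obtain ⟨p, hp1, hp2⟩ := hμ.exists_polynomial_minorant hcont h0 hle hε
  have hPe : ∀ t : ℝ, (1 - (1 + X ^ 2) * p).eval t = 1 - (1 + t ^ 2) * p.eval t := by simp
  obtain ⟨s, hs⟩ := (1 - (1 + X ^ 2) * p).exists_map_eq_mul_conj_of_nonneg fun t => by
    have := mul_le_mul_of_nonneg_left (hp1 t) (by positivity : 0 ≤ 1 + t ^ 2)
    rw [mul_inv_cancel₀ (hne t)] at this
    rw [hPe]
    linarith
  -- The factor 1 + X² vanishes at i. Hence one of s and its conjugate polynomial has modulus at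
  -- least 1 there, and on the line the two have equal moduli.
  have hI : s.eval Complex.I * (s.map (starRingEnd ℂ)).eval Complex.I = 1 := by
    rw [← eval_mul, ← hs]
    simp
  have hconj : ∀ t : ℝ, (s.map (starRingEnd ℂ)).eval (t : ℂ) = starRingEnd ℂ (s.eval (t : ℂ)) := by
    intro t
    conv_lhs => rw [← Complex.conj_ofReal t]
    rw [eval_map_apply]
  have hnorm : ∀ t : ℝ, ‖s.eval (t : ℂ)‖ ^ 2 = 1 - (1 + t ^ 2) * p.eval t := by
    intro t
    have h1 : ((1 - (1 + X ^ 2) * p).map (algebraMap ℝ ℂ)).eval (t : ℂ)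
        = (((1 - (1 + X ^ 2) * p).eval t : ℝ) : ℂ) := by
      rw [← Complex.coe_algebraMap, eval_map_apply]
    rw [hs, eval_mul, hconj, Complex.mul_conj, hPe, Complex.ofReal_inj] at h1
    rw [← h1, Complex.normSq_eq_norm_sq]
  have hint : Integrable (fun t : ℝ => (1 + t ^ 2)⁻¹) μ :=
    Integrable.of_bound hcont.aestronglyMeasurable 1
      (Eventually.of_forall fun t => by rw [Real.norm_of_nonneg (h0 t)]; exact hle t)
  have hfun : (fun t : ℝ => ‖s.eval (t : ℂ)‖ ^ 2 / (1 + t ^ 2))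
      = fun t => (1 + t ^ 2)⁻¹ - p.eval t := by
    ext t
    rw [hnorm]
    field_simp
  have hfint : Integrable (fun t : ℝ => ‖s.eval (t : ℂ)‖ ^ 2 / (1 + t ^ 2)) μ :=
    hfun ▸ hint.sub (hμ.integrable_eval p)
  have hlt : ∫ t : ℝ, ‖s.eval (t : ℂ)‖ ^ 2 / (1 + t ^ 2) ∂μ < ε := by
    rw [← integral_sub hint (hμ.integrable_eval p)] at hp2
    rwa [hfun]
  by_cases h : 1 ≤ ‖s.eval Complex.I‖
  · exact ⟨s, h, hfint, hlt⟩
  · refine ⟨s.map (starRingEnd ℂ), ?_, by simpa only [hconj, RCLike.norm_conj] using hfint,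
      by simpa only [hconj, RCLike.norm_conj] using hlt⟩
    have h1 := congrArg norm hI
    rw [norm_mul, norm_one] at h1
    nlinarith [norm_nonneg (s.eval Complex.I), norm_nonneg ((s.map (starRingEnd ℂ)).eval Complex.I)]

theorem measurable_ofReal_pow (m : ℕ) : Measurable fun t : ℝ => ENNReal.ofReal (t ^ (2 * m)) := by
  fun_prop

theorem toReal_ofReal_pow (m : ℕ) (t : ℝ) :
    (ENNReal.ofReal (t ^ (2 * m))).toReal = t ^ (2 * m) :=
  ENNReal.toReal_ofReal (by rw [pow_mul]; positivity)

theorem evenPowerWeighted_zero (μ : Measure ℝ) : evenPowerWeighted μ 0 = μ := by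
  simp [evenPowerWeighted]

/-! ### Orthogonality to high powers of a real function -/

section Pushforward

variable {Ω : Type*} [MeasurableSpace Ω] {α : Measure Ω} {τ : Ω → ℝ}

theorem integral_evenPowerWeighted_map (hτ : Measurable τ) (m : ℕ) {f : ℝ → ℝ}
    (hf : Measurable f) :
    ∫ t, f t ∂evenPowerWeighted (α.map τ) m = ∫ ω, τ ω ^ (2 * m) * f (τ ω) ∂α := by
  rw [evenPowerWeighted, integral_withDensity_eq_integral_toReal_smul (measurable_ofReal_pow m)
    (Eventually.of_forall fun _ => ENNReal.ofReal_lt_top), integral_map hτ.aemeasurable]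
  · simp only [toReal_ofReal_pow, smul_eq_mul]
  · exact (((measurable_ofReal_pow m).ennreal_toReal).mul hf).aestronglyMeasurable

theorem integrable_evenPowerWeighted_map (hτ : Measurable τ) (m : ℕ) {f : ℝ → ℝ}
    (hf : Measurable f) :
    Integrable f (evenPowerWeighted (α.map τ) m) ↔
      Integrable (fun ω => τ ω ^ (2 * m) * f (τ ω)) α := by
  rw [evenPowerWeighted, integrable_withDensity_iff_integrable_smul' (measurable_ofReal_pow m)
    (Eventually.of_forall fun _ => ENNReal.ofReal_lt_top), integrable_map_measure
    (Measurable.aestronglyMeasurable (by fun_prop)) hτ.aemeasurable]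
  simp only [Function.comp_def, toReal_ofReal_pow, smul_eq_mul]

theorem memLp_two_pow (hτ : Measurable τ)
    (hmom : ∀ n : ℕ, Integrable (fun ω => τ ω ^ n) α) (n : ℕ) :
    MemLp (fun ω => τ ω ^ n) 2 α := by
  refine (memLp_two_iff_integrable_sq (hτ.pow_const n).aestronglyMeasurable).2 ?_
  simpa only [← pow_mul] using hmom (n * 2)

theorem integrable_mul_pow (hτ : Measurable τ)
    (hmom : ∀ n : ℕ, Integrable (fun ω => τ ω ^ n) α) {G : Ω → ℂ} (hG : MemLp G 2 α) (n : ℕ) :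
    Integrable (fun ω => G ω * (τ ω : ℂ) ^ n) α := by
  have h := (memLp_two_pow hτ hmom n).ofReal (K := ℂ)
  simpa [Pi.mul_def] using hG.integrable_mul h

open Polynomial in
theorem integrable_mul_eval (hτ : Measurable τ)
    (hmom : ∀ n : ℕ, Integrable (fun ω => τ ω ^ n) α) {G : Ω → ℂ} (hG : MemLp G 2 α) (m : ℕ)
    (s : ℂ[X]) : Integrable (fun ω => G ω * (τ ω : ℂ) ^ m * s.eval (τ ω : ℂ)) α := by
  induction s using Polynomial.induction_on' with
  | add p q hp hq => simp only [eval_add, mul_add]; exact hp.add hq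
  | monomial n a =>
    refine ((integrable_mul_pow hτ hmom hG (m + n)).const_mul a).congr
      (Eventually.of_forall fun ω => ?_)
    simp only [eval_monomial]; ring

open Polynomial in
theorem integral_mul_eval_eq_zero (hτ : Measurable τ)
    (hmom : ∀ n : ℕ, Integrable (fun ω => τ ω ^ n) α) {G : Ω → ℂ} (hG : MemLp G 2 α) {m : ℕ}
    (h : ∀ n, ∫ ω, G ω * (τ ω : ℂ) ^ (m + n) ∂α = 0) (s : ℂ[X]) :
    ∫ ω, G ω * (τ ω : ℂ) ^ m * s.eval (τ ω : ℂ) ∂α = 0 := by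
  induction s using Polynomial.induction_on' with
  | add p q hp hq =>
    simp only [eval_add, mul_add]
    rw [integral_add (integrable_mul_eval hτ hmom hG m p) (integrable_mul_eval hτ hmom hG m q),
      hp, hq, add_zero]
  | monomial n a =>
    rw [← mul_zero a, ← h n, ← integral_const_mul]
    refine integral_congr_ae (Eventually.of_forall fun ω => ?_)
    simp only [eval_monomial]; ring

theorem Complex.ofReal_sub_I_ne_zero (t : ℝ) : (t : ℂ) - Complex.I ≠ 0 := fun h => by
  simpa using congrArg Complex.im h

theorem Complex.sq_norm_ofReal_sub_I (t : ℝ) : ‖(t : ℂ) - Complex.I‖ ^ 2 = 1 + t ^ 2 := by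
  rw [Complex.sq_norm, Complex.normSq_apply]
  simp; ring

theorem Complex.norm_inv_ofReal_sub_I_le (t : ℝ) : ‖((t : ℂ) - Complex.I)⁻¹‖ ≤ 1 := by
  rw [norm_inv]
  refine inv_le_one_of_one_le₀ ?_
  have := Complex.sq_norm_ofReal_sub_I t
  nlinarith [norm_nonneg ((t : ℂ) - Complex.I), sq_nonneg t]

theorem measurable_inv_ofReal_sub_I (hτ : Measurable τ) :
    Measurable fun ω => ((τ ω : ℂ) - Complex.I)⁻¹ :=
  ((Complex.measurable_ofReal.comp hτ).sub_const _).inv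

open Polynomial in
/-- Functions orthogonal to the powers `τ ^ (m + n)` are orthogonal to `τ ^ m / (τ - i)` times any
polynomial in `τ`. -/
theorem integral_mul_eval_div_eq_zero (hτ : Measurable τ)
    (hmom : ∀ n : ℕ, Integrable (fun ω => τ ω ^ n) α) {m : ℕ}
    (hdet : HamburgerDeterminate (evenPowerWeighted (α.map τ) m))
    {G : Ω → ℂ} (hG : MemLp G 2 α) (h : ∀ n, ∫ ω, G ω * (τ ω : ℂ) ^ (m + n) ∂α = 0) (s : ℂ[X]) :
    ∫ ω, G ω * (τ ω : ℂ) ^ m * s.eval (τ ω : ℂ) * ((τ ω : ℂ) - Complex.I)⁻¹ ∂α = 0 := by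
  have hint : ∀ s : ℂ[X], Integrable
      (fun ω => G ω * (τ ω : ℂ) ^ m * s.eval (τ ω : ℂ) * ((τ ω : ℂ) - Complex.I)⁻¹) α := fun s =>
    (integrable_mul_eval hτ hmom hG m s).mul_bdd (c := 1)
      (measurable_inv_ofReal_sub_I hτ).aestronglyMeasurable
      (Eventually.of_forall fun ω => Complex.norm_inv_ofReal_sub_I_le _)
  set c : ℂ := ∫ ω, G ω * (τ ω : ℂ) ^ m * (1 : ℂ[X]).eval (τ ω : ℂ) *
    ((τ ω : ℂ) - Complex.I)⁻¹ ∂α with hc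
  have key : ∀ s : ℂ[X],
      ∫ ω, G ω * (τ ω : ℂ) ^ m * s.eval (τ ω : ℂ) * ((τ ω : ℂ) - Complex.I)⁻¹ ∂α
        = s.eval Complex.I * c := by
    intro s
    -- Since s(τ) − s(i) = (τ − i) r(τ), the two integrals differ by that of G τ^m r(τ), which is
    -- zero.
    obtain ⟨r, hr⟩ := X_sub_C_dvd_sub_C_eval (a := Complex.I) (p := s)
    rw [hc, ← integral_const_mul, ← sub_eq_zero, ← integral_sub (hint s) ((hint 1).const_mul _),
      ← integral_mul_eval_eq_zero hτ hmom hG h r]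
    refine integral_congr_ae (Eventually.of_forall fun ω => ?_)
    have h1 := congrArg (Polynomial.eval (τ ω : ℂ)) hr
    simp only [eval_sub, eval_mul, eval_X, eval_C] at h1
    have h2 := Complex.ofReal_sub_I_ne_zero (τ ω)
    simp only [eval_one]
    field_simp
    linear_combination G ω * (τ ω : ℂ) ^ m * h1
  suffices hc0 : c = 0 by rw [key, hc0, mul_zero]
  by_contra hne
  have hcpos : 0 < ‖c‖ := norm_pos_iff.2 hne
  set A : ℝ := ∫ ω, ‖G ω‖ ^ 2 ∂α
  have hA : 0 ≤ A := integral_nonneg fun ω => by positivity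
  have hG2 : Integrable (fun ω => ‖G ω‖ ^ 2) α := hG.norm.integrable_sq
  -- Chosen so that the weighted AM–GM estimate below gives ‖c‖ ≤ l(A + 1)/2 = ‖c‖/2.
  set l : ℝ := ‖c‖ / (A + 1) with hl
  have hlpos : 0 < l := by positivity
  obtain ⟨s, hs1, hs2, hs3⟩ := hdet.exists_polynomial_integral_lt (ε := l ^ 2) (by positivity)
  have hmeas : Measurable fun t : ℝ => ‖s.eval (t : ℂ)‖ ^ 2 / (1 + t ^ 2) := by
    have : Continuous fun t : ℝ => s.eval (t : ℂ) := s.continuous.comp Complex.continuous_ofReal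
    exact (this.norm.pow 2).measurable.div (by fun_prop)
  rw [integrable_evenPowerWeighted_map hτ m hmeas] at hs2
  rw [integral_evenPowerWeighted_map hτ m hmeas] at hs3
  have hbound : ‖c‖ ≤ l / 2 * A + 1 / (2 * l) *
      ∫ ω, τ ω ^ (2 * m) * (‖s.eval (τ ω : ℂ)‖ ^ 2 / (1 + τ ω ^ 2)) ∂α := by
    calc ‖c‖ ≤ ‖s.eval Complex.I * c‖ := by
          rw [norm_mul]; exact le_mul_of_one_le_left (norm_nonneg _) hs1
      _ = ‖∫ ω, G ω * (τ ω : ℂ) ^ m * s.eval (τ ω : ℂ) * ((τ ω : ℂ) - Complex.I)⁻¹ ∂α‖ := by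
          rw [key]
      _ ≤ ∫ ω, (l / 2 * ‖G ω‖ ^ 2 + 1 / (2 * l) *
            (τ ω ^ (2 * m) * (‖s.eval (τ ω : ℂ)‖ ^ 2 / (1 + τ ω ^ 2)))) ∂α := by
          refine norm_integral_le_of_norm_le ((hG2.const_mul _).add (hs2.const_mul _))
            (Eventually.of_forall fun ω => ?_)
          set y : ℝ := |τ ω| ^ m * ‖s.eval (τ ω : ℂ)‖ * ‖(τ ω : ℂ) - Complex.I‖⁻¹ with hy
          have e1 : ‖G ω * (τ ω : ℂ) ^ m * s.eval (τ ω : ℂ) * ((τ ω : ℂ) - Complex.I)⁻¹‖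
              = ‖G ω‖ * y := by
            simp only [norm_mul, norm_pow, norm_inv, Complex.norm_real, Real.norm_eq_abs, hy]
            ring
          have e2 : τ ω ^ (2 * m) * (‖s.eval (τ ω : ℂ)‖ ^ 2 / (1 + τ ω ^ 2)) = y ^ 2 := by
            rw [hy, mul_pow, mul_pow, inv_pow, Complex.sq_norm_ofReal_sub_I, ← pow_mul,
              mul_comm m 2, pow_mul |τ ω|, sq_abs, ← pow_mul]
            ring
          rw [e1, e2]
          have : l / 2 * ‖G ω‖ ^ 2 + 1 / (2 * l) * y ^ 2 - ‖G ω‖ * y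
              = (l * ‖G ω‖ - y) ^ 2 / (2 * l) := by field_simp; ring
          have h3 : 0 ≤ (l * ‖G ω‖ - y) ^ 2 / (2 * l) := by positivity
          linarith
      _ = _ := by
          rw [integral_add (hG2.const_mul _) (hs2.const_mul _), integral_const_mul,
            integral_const_mul]
  have h1 : 1 / (2 * l) * (∫ ω, τ ω ^ (2 * m) * (‖s.eval (τ ω : ℂ)‖ ^ 2 / (1 + τ ω ^ 2)) ∂α)
      ≤ 1 / (2 * l) * l ^ 2 := by gcongr
  have h2 : 1 / (2 * l) * l ^ 2 = l / 2 := by field_simp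
  have h3 : l * (A + 1) = ‖c‖ := div_mul_cancel₀ _ (by positivity)
  nlinarith

/-- Orthogonality to the powers `τ ^ (m + n)` is preserved by division by `1 + τ ^ 2`. -/
theorem integral_div_one_add_sq_mul_pow_eq_zero (hτ : Measurable τ)
    (hmom : ∀ n : ℕ, Integrable (fun ω => τ ω ^ n) α) {m : ℕ}
    (hdet : HamburgerDeterminate (evenPowerWeighted (α.map τ) m))
    {G : Ω → ℝ} (hG : MemLp G 2 α) (h : ∀ n, ∫ ω, G ω * τ ω ^ (m + n) ∂α = 0) (n : ℕ) :
    ∫ ω, G ω * (1 + τ ω ^ 2)⁻¹ * τ ω ^ (m + n) ∂α = 0 := by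
  have hGC : MemLp (fun ω => (G ω : ℂ)) 2 α := hG.ofReal
  have h1 := integral_mul_eval_div_eq_zero hτ hmom hdet hGC (fun n => by
    rw [← Complex.ofReal_zero, ← h n, ← integral_complex_ofReal]
    simp) (Polynomial.X ^ n)
  have hint := (integrable_mul_eval hτ hmom hGC m (Polynomial.X ^ n)).mul_bdd (c := 1)
      (measurable_inv_ofReal_sub_I hτ).aestronglyMeasurable
      (Eventually.of_forall fun ω => Complex.norm_inv_ofReal_sub_I_le _)
  -- As `G` and `τ` are real, only Im (τ − i)⁻¹ = (1 + τ²)⁻¹ contributes.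
  have h2 := integral_im hint
  rw [h1, map_zero] at h2
  rw [← h2]
  refine integral_congr_ae (Eventually.of_forall fun ω => ?_)
  have e : (G ω : ℂ) * (τ ω : ℂ) ^ m * (Polynomial.X ^ n : Polynomial ℂ).eval (τ ω : ℂ)
      = ((G ω * τ ω ^ (m + n) : ℝ) : ℂ) := by
    simp [pow_add]; ring
  simp only [e]
  change _ = Complex.im _
  rw [Complex.im_ofReal_mul, Complex.inv_im, Complex.normSq_eq_norm_sq,
    Complex.sq_norm_ofReal_sub_I]
  simp
  ring

/-- `ENNReal.ofReal` truncates at zero, so the two densities are the positive and negative parts of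
`v`; this replaces a signed pushforward by two positive measures. -/
theorem integral_comp_sub_integral_comp (hτ : Measurable τ) {v : Ω → ℝ} (hv : Integrable v α)
    (hvm : Measurable v) {ψ : ℝ → ℝ} (hψ : Measurable ψ) {C : ℝ} (hC : ∀ t, |ψ t| ≤ C) :
    ∫ t, ψ t ∂(α.withDensity fun ω => ENNReal.ofReal (v ω)).map τ
      - ∫ t, ψ t ∂(α.withDensity fun ω => ENNReal.ofReal (-v ω)).map τ
      = ∫ ω, v ω * ψ (τ ω) ∂α := by
  have key : ∀ w : Ω → ℝ, Measurable w →
      ∫ t, ψ t ∂(α.withDensity fun ω => ENNReal.ofReal (w ω)).map τ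
        = ∫ ω, max (w ω) 0 * ψ (τ ω) ∂α := fun w hw => by
    rw [integral_map hτ.aemeasurable hψ.aestronglyMeasurable,
      integral_withDensity_eq_integral_toReal_smul hw.ennreal_ofReal
        (Eventually.of_forall fun _ => ENNReal.ofReal_lt_top)]
    simp only [ENNReal.toReal_ofReal', smul_eq_mul]
  have hi : ∀ w : Ω → ℝ, Integrable w α → Integrable (fun ω => max (w ω) 0 * ψ (τ ω)) α :=
    fun w hw => hw.pos_part.mul_bdd (c := C) (hψ.comp hτ).aestronglyMeasurable
      (Eventually.of_forall fun ω => hC _)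
  rw [key v hvm, key (fun ω => -v ω) hvm.neg, ← integral_sub (hi v hv) (hi (fun ω => -v ω) hv.neg)]
  refine integral_congr_ae (Eventually.of_forall fun ω => ?_)
  simp only
  rcases le_total 0 (v ω) with h | h
  · rw [max_eq_left h, max_eq_right (by simpa using h)]; ring
  · rw [max_eq_right h, max_eq_left (by simpa using h)]; ring

open BoundedContinuousFunction in
-- Orthogonality to all τ^(m+n) is stable under multiplication by a point-separating algebra of
-- bounded continuous functions. Such an algebra determines finite measures, so the positive and
-- negative parts of G τ^m have the same image under `τ`.
theorem integral_mul_pow_mul_eq_zero_of_bounded (hτ : Measurable τ)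
    (hmom : ∀ n : ℕ, Integrable (fun ω => τ ω ^ n) α) {m : ℕ}
    (hdet : HamburgerDeterminate (evenPowerWeighted (α.map τ) m))
    {G : Ω → ℝ} (hGm : Measurable G) (hG : MemLp G 2 α)
    (h : ∀ n, ∫ ω, G ω * τ ω ^ (m + n) ∂α = 0)
    {ψ : ℝ → ℝ} (hψ : Measurable ψ) {C : ℝ} (hC : ∀ t, |ψ t| ≤ C) :
    ∫ ω, G ω * τ ω ^ m * ψ (τ ω) ∂α = 0 := by
  have hne : ∀ t : ℝ, 1 + t ^ 2 ≠ 0 := fun t => by positivity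
  let a : ℝ →ᵇ ℝ := BoundedContinuousFunction.ofNormedAddCommGroup (fun t => (1 + t ^ 2)⁻¹)
    (by fun_prop (disch := exact hne _)) 1 fun t => by
      rw [Real.norm_of_nonneg (by positivity)]
      exact inv_le_one_of_one_le₀ (by nlinarith [sq_nonneg t])
  let b : ℝ →ᵇ ℝ := BoundedContinuousFunction.ofNormedAddCommGroup (fun t => t * (1 + t ^ 2)⁻¹)
    (by fun_prop (disch := exact hne _)) 1 fun t => by
      rw [← div_eq_mul_inv, norm_div, Real.norm_of_nonneg (show 0 ≤ 1 + t ^ 2 by positivity),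
        div_le_one (by positivity), Real.norm_eq_abs]
      nlinarith [sq_nonneg (|t| - 1), sq_abs t]
  have hmul : ∀ (G : Ω → ℝ) (φ : ℝ →ᵇ ℝ), MemLp G 2 α → MemLp (fun ω => G ω * φ (τ ω)) 2 α := by
    intro G φ hG
    refine (hG.const_mul ‖φ‖).of_le (hG.1.mul (φ.continuous.measurable.comp hτ).aestronglyMeasurable)
      (Eventually.of_forall fun ω => ?_)
    rw [norm_mul, norm_mul, norm_norm, mul_comm]
    gcongr
    exact φ.norm_coe_le_norm _
  have hintG : ∀ (G : Ω → ℝ) n, MemLp G 2 α → Integrable (fun ω => G ω * τ ω ^ n) α :=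
    fun G n hG => hG.integrable_mul (memLp_two_pow hτ hmom n)
  let A : StarSubalgebra ℝ (ℝ →ᵇ ℝ) := StarAlgebra.adjoin ℝ {a, b}
  have hA : ∀ φ ∈ A, ∀ G : Ω → ℝ, MemLp G 2 α → (∀ n, ∫ ω, G ω * τ ω ^ (m + n) ∂α = 0) →
      ∀ n, ∫ ω, G ω * φ (τ ω) * τ ω ^ (m + n) ∂α = 0 := by
    intro φ hφ
    induction hφ using StarAlgebra.adjoin_induction with
    | mem φ hφ =>
      intro G hG h n
      rcases hφ with rfl | rfl
      · exact integral_div_one_add_sq_mul_pow_eq_zero hτ hmom hdet hG h n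
      -- The extra factor t in `b` is absorbed into the exponent, which is why all `n` are carried
      -- along.
      · rw [← integral_div_one_add_sq_mul_pow_eq_zero hτ hmom hdet hG h (n + 1)]
        refine integral_congr_ae (Eventually.of_forall fun ω => ?_)
        simp only [b, coe_ofNormedAddCommGroup]
        ring
    | algebraMap r =>
      intro G hG h n
      rw [← mul_zero r, ← h n, ← integral_const_mul]
      refine integral_congr_ae (Eventually.of_forall fun ω => ?_)
      have : (algebraMap ℝ (ℝ →ᵇ ℝ) r) (τ ω) = r := by
        rw [BoundedContinuousFunction.algebraMap_apply, smul_eq_mul, mul_one]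
      simp only [this]
      ring
    | add φ ψ _ _ hφ hψ =>
      intro G hG h n
      simp only [coe_add, Pi.add_apply, mul_add, add_mul]
      rw [integral_add (hintG _ _ (hmul G φ hG)) (hintG _ _ (hmul G ψ hG)), hφ G hG h, hψ G hG h,
        add_zero]
    | mul φ ψ _ _ hφ hψ =>
      intro G hG h n
      simpa only [coe_mul, Pi.mul_apply, mul_assoc] using hψ _ (hmul G φ hG) (hφ G hG h) n
    | star φ _ hφ => simpa using hφ
  have hvint : Integrable (fun ω => G ω * τ ω ^ m) α := hintG G m hG
  have hvm : Measurable fun ω => G ω * τ ω ^ m := hGm.mul (hτ.pow_const m)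
  have hfin : ∀ w : Ω → ℝ, Integrable w α →
      IsFiniteMeasure ((α.withDensity fun ω => ENNReal.ofReal (w ω)).map τ) := fun w hw => by
    have := isFiniteMeasure_withDensity_ofReal hw.2
    infer_instance
  have i1 := hfin _ hvint
  have i2 := hfin _ hvint.neg
  have heq : (α.withDensity fun ω => ENNReal.ofReal (G ω * τ ω ^ m)).map τ
      = (α.withDensity fun ω => ENNReal.ofReal (-(G ω * τ ω ^ m))).map τ := by
    refine ext_of_forall_mem_subalgebra_integral_eq_of_pseudoEMetric_complete_countable
      (𝕜 := ℝ) (A := A) ?_ fun φ hφ => ?_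
    · intro x y hxy
      by_contra! hcon
      have ha : a x = a y := hcon _ ⟨_, ⟨a, StarAlgebra.subset_adjoin ℝ _ (by simp), rfl⟩, rfl⟩
      have hb : b x = b y := hcon _ ⟨_, ⟨b, StarAlgebra.subset_adjoin ℝ _ (by simp), rfl⟩, rfl⟩
      simp only [a, b, coe_ofNormedAddCommGroup] at ha hb
      rw [ha] at hb
      exact hxy (mul_right_cancel₀ (inv_ne_zero (hne y)) hb)
    · rw [← sub_eq_zero, integral_comp_sub_integral_comp hτ hvint hvm φ.continuous.measurable
        (fun t => φ.norm_coe_le_norm t), ← hA φ hφ G hG h 0]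
      refine integral_congr_ae (Eventually.of_forall fun ω => ?_)
      simp only [add_zero]; ring
  rw [← integral_comp_sub_integral_comp hτ hvint hvm hψ hC, heq, sub_self]

/-- A square integrable function that is orthogonal to all high powers of `τ` has mean zero on the
set `τ ≠ 0`, if the weighted distributions of `τ` are determinate. -/
theorem setIntegral_ne_zero_eq_zero_real (hτ : Measurable τ)
    (hmom : ∀ n : ℕ, Integrable (fun ω => τ ω ^ n) α) [IsFiniteMeasure α] {m : ℕ}
    (hdet : HamburgerDeterminate (evenPowerWeighted (α.map τ) m))
    {G : Ω → ℝ} (hGm : Measurable G) (hG : MemLp G 2 α)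
    (h : ∀ n, ∫ ω, G ω * τ ω ^ (m + n) ∂α = 0) :
    ∫ ω in {ω | τ ω ≠ 0}, G ω ∂α = 0 := by
  have hGi : Integrable G α := hG.integrable one_le_two
  -- Away from 0 the function t^(−m) is bounded and can serve as the test function that cancels τ^m;
  -- the sets increase to the complement of 0.
  let S : ℕ → Set ℝ := fun k => {t | 1 / ((k : ℝ) + 1) ≤ |t|}
  have hS : ∀ k, MeasurableSet (S k) := fun k => measurableSet_le measurable_const measurable_norm
  have h1 : ∀ k : ℕ, ∫ ω, (τ ⁻¹' S k).indicator G ω ∂α = 0 := fun k => by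
    have hk : (0 : ℝ) < (k : ℝ) + 1 := by positivity
    rw [← integral_mul_pow_mul_eq_zero_of_bounded hτ hmom hdet hGm hG h
      (ψ := (S k).indicator fun t => (t ^ m)⁻¹) (Measurable.indicator (by fun_prop) (hS k))
      (C := ((k : ℝ) + 1) ^ m) ?_]
    · refine integral_congr_ae (Eventually.of_forall fun ω => ?_)
      by_cases hω : τ ω ∈ S k
      · have hne : τ ω ≠ 0 := fun h0 => by
          have : 1 / ((k : ℝ) + 1) ≤ |τ ω| := hω
          rw [h0, abs_zero] at this
          exact absurd this (not_le.2 (by positivity))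
        simp only [Set.indicator_of_mem hω, Set.indicator_of_mem (Set.mem_preimage.2 hω)]
        field_simp
      · simp only [Set.indicator_of_notMem hω, mul_zero,
          Set.indicator_of_notMem (fun h' => hω (Set.mem_preimage.1 h'))]
    · intro t
      by_cases ht : t ∈ S k
      · rw [Set.indicator_of_mem ht, abs_inv, abs_pow, ← inv_pow]
        gcongr
        rw [inv_le_comm₀ ((by positivity : (0 : ℝ) < 1 / ((k : ℝ) + 1)).trans_le ht) hk, ← one_div]
        exact ht
      · rw [Set.indicator_of_notMem ht, abs_zero]; positivity
  have hms : MeasurableSet {ω | τ ω ≠ 0} := (hτ (measurableSet_singleton 0)).compl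
  have lim : Tendsto (fun k => ∫ ω, (τ ⁻¹' S k).indicator G ω ∂α) atTop
      (𝓝 (∫ ω, {ω | τ ω ≠ 0}.indicator G ω ∂α)) := by
    refine tendsto_integral_of_dominated_convergence (fun ω => ‖G ω‖)
      (fun k => hGi.1.indicator (hτ (hS k))) hGi.norm
      (fun k => Eventually.of_forall fun ω => norm_indicator_le_norm_self _ _)
      (Eventually.of_forall fun ω => ?_)
    by_cases hω : τ ω = 0
    · rw [Set.indicator_of_notMem (by simpa using hω)]
      refine tendsto_const_nhds.congr fun k => ?_
      rw [Set.indicator_of_notMem]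
      simp only [S, Set.mem_preimage, Set.mem_ofPred_eq, hω, abs_zero, not_le]
      positivity
    · rw [Set.indicator_of_mem (by simpa using hω)]
      refine tendsto_const_nhds.congr' ?_
      filter_upwards [tendsto_one_div_add_atTop_nhds_zero_nat.eventually
        (eventually_le_nhds (abs_pos.2 hω))] with k hk
      rw [Set.indicator_of_mem]
      exact hk
  simp only [h1] at lim
  rw [← integral_indicator hms]
  exact (tendsto_nhds_unique lim tendsto_const_nhds)

theorem setIntegral_ne_zero_eq_zero (hτ : Measurable τ)
    (hmom : ∀ n : ℕ, Integrable (fun ω => τ ω ^ n) α) [IsFiniteMeasure α] {m : ℕ}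
    (hdet : HamburgerDeterminate (evenPowerWeighted (α.map τ) m))
    {G : Ω → ℂ} (hGm : Measurable G) (hG : MemLp G 2 α)
    (h : ∀ n, ∫ ω, G ω * (τ ω : ℂ) ^ (m + n) ∂α = 0) :
    ∫ ω in {ω | τ ω ≠ 0}, G ω ∂α = 0 := by
  have hint := fun n => integrable_mul_pow hτ hmom hG (m + n)
  have hGi : Integrable G α := hG.integrable one_le_two
  have hre : ∫ ω in {ω | τ ω ≠ 0}, (G ω).re ∂α = 0 :=
    setIntegral_ne_zero_eq_zero_real hτ hmom hdet (Complex.measurable_re.comp hGm) hG.re fun n => by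
      have := integral_re (hint n)
      rw [h n, map_zero] at this
      simpa only [← Complex.ofReal_pow, RCLike.re_to_complex, Complex.re_mul_ofReal] using this
  have him : ∫ ω in {ω | τ ω ≠ 0}, (G ω).im ∂α = 0 :=
    setIntegral_ne_zero_eq_zero_real hτ hmom hdet (Complex.measurable_im.comp hGm) hG.im fun n => by
      have := integral_im (hint n)
      rw [h n, map_zero] at this
      simpa only [← Complex.ofReal_pow, RCLike.im_to_complex, Complex.im_mul_ofReal] using this
  have h1 := integral_re hGi.integrableOn (f := G) (μ := α.restrict {ω | τ ω ≠ 0})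
  have h2 := integral_im hGi.integrableOn (f := G) (μ := α.restrict {ω | τ ω ≠ 0})
  simp only [RCLike.re_to_complex, RCLike.im_to_complex] at h1 h2
  exact Complex.ext (h1.symm.trans hre) (h2.symm.trans him)

end Pushforward

/-! ### Spectral representation of the Hilbert space -/

section PlaneWave

variable {d : ℕ}

/-- The function `t ↦ exp (i ⟨t, x⟩)`. -/
noncomputable def planeWave (x t : EuclideanSpace ℝ (Fin d)) : ℂ :=
  Complex.exp (Complex.I * ((∑ j, t j * x j : ℝ) : ℂ))

theorem norm_planeWave (x t : EuclideanSpace ℝ (Fin d)) : ‖planeWave x t‖ = 1 :=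
  Complex.norm_exp_I_mul_ofReal _

theorem measurable_planeWave (x : EuclideanSpace ℝ (Fin d)) : Measurable (planeWave x) := by
  unfold planeWave; fun_prop

theorem planeWave_add (x y t : EuclideanSpace ℝ (Fin d)) :
    planeWave (x + y) t = planeWave x t * planeWave y t := by
  simp only [planeWave, ← Complex.exp_add, ← mul_add, ← Complex.ofReal_add,
    ← Finset.sum_add_distrib, PiLp.add_apply]

theorem planeWave_single (i : Fin d) (s : ℝ) (t : EuclideanSpace ℝ (Fin d)) :
    planeWave (EuclideanSpace.single i s) t = Complex.exp (Complex.I * (t i * s : ℝ)) := by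
  simp [planeWave]

theorem conj_planeWave (x t : EuclideanSpace ℝ (Fin d)) :
    starRingEnd ℂ (planeWave x t) = planeWave (-x) t := by
  simp only [planeWave, ← Complex.exp_conj, map_mul, Complex.conj_I, Complex.conj_ofReal,
    PiLp.neg_apply, mul_neg, Finset.sum_neg_distrib, Complex.ofReal_neg, neg_mul]

theorem memLp_planeWave (α : Measure (EuclideanSpace ℝ (Fin d))) [IsFiniteMeasure α]
    (x : EuclideanSpace ℝ (Fin d)) : MemLp (planeWave x) 2 α :=
  MemLp.of_bound (measurable_planeWave x).aestronglyMeasurable 1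
    (Eventually.of_forall fun t => (norm_planeWave x t).le)

theorem memLp_mul_planeWave {α : Measure (EuclideanSpace ℝ (Fin d))}
    {g : EuclideanSpace ℝ (Fin d) → ℂ} {p : ENNReal} (hg : MemLp g p α)
    (x : EuclideanSpace ℝ (Fin d)) : MemLp (fun t => g t * planeWave x t) p α :=
  hg.of_le (hg.1.mul (measurable_planeWave x).aestronglyMeasurable)
    (Eventually.of_forall fun t => by rw [norm_mul, norm_planeWave, mul_one])

theorem integrable_mul_planeWave {α : Measure (EuclideanSpace ℝ (Fin d))}
    {g : EuclideanSpace ℝ (Fin d) → ℂ} (hg : Integrable g α)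
    (x : EuclideanSpace ℝ (Fin d)) : Integrable (fun t => g t * planeWave x t) α :=
  memLp_one_iff_integrable.1 (memLp_mul_planeWave (memLp_one_iff_integrable.2 hg) x)

theorem inner_toLp_planeWave {α : Measure (EuclideanSpace ℝ (Fin d))} [IsFiniteMeasure α]
    {k : EuclideanSpace ℝ (Fin d) → ℝ} (hα : IsSpectralMeasure α k)
    (x y : EuclideanSpace ℝ (Fin d)) :
    inner ℂ (memLp_planeWave α y).toLp (memLp_planeWave α x).toLp = (k (x - y) : ℂ) := by
  rw [L2.inner_def, hα.2]
  refine integral_congr_ae ?_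
  filter_upwards [(memLp_planeWave α y).coeFn_toLp, (memLp_planeWave α x).coeFn_toLp] with t h1 h2
  rw [h1, h2, RCLike.inner_apply, conj_planeWave, ← planeWave_add, ← sub_eq_add_neg]
  rfl

theorem real_inner_toLp_planeWave {α : Measure (EuclideanSpace ℝ (Fin d))} [IsFiniteMeasure α]
    {k : EuclideanSpace ℝ (Fin d) → ℝ} (hα : IsSpectralMeasure α k)
    (x y : EuclideanSpace ℝ (Fin d)) :
    inner ℝ (memLp_planeWave α y).toLp (memLp_planeWave α x).toLp = k (x - y) := by
  have h := inner_toLp_planeWave hα x y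
  have h2 := integral_re (L2.integrable_inner (𝕜 := ℂ) (memLp_planeWave α y).toLp
    (memLp_planeWave α x).toLp)
  rw [← L2.inner_def, h] at h2
  rw [L2.inner_def]
  refine Eq.trans (integral_congr_ae (Eventually.of_forall fun t => ?_)) (h2.trans (by simp))
  simp only [Complex.inner, RCLike.inner_apply, RCLike.re_to_complex]

variable {X : Set (EuclideanSpace ℝ (Fin d))} {k : EuclideanSpace ℝ (Fin d) → ℝ}
  {α : Measure (EuclideanSpace ℝ (Fin d))} {H : Type*} [NormedAddCommGroup H]
  [InnerProductSpace ℝ H] [CompleteSpace H] [RKHS ℝ H X ℝ]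

theorem inner_kerFun_kerFun (hH : IsRKHSOfTranslationKernel X k H) (x y : X) :
    inner ℝ (RKHS.kerFun H y (1 : ℝ)) (RKHS.kerFun H x 1)
      = k ((x : EuclideanSpace ℝ (Fin d)) - y) := by
  rw [← RKHS.kernel_inner, hH x y]
  simp

variable (X H) in
theorem denseRange_linearCombination_kerFun :
    DenseRange (Finsupp.linearCombination ℝ fun x : X => RKHS.kerFun H x (1 : ℝ)) := by
  have h1 : (Submodule.span ℝ {RKHS.kerFun H x v | (x : X) (v : ℝ)}) ≤
      LinearMap.range (Finsupp.linearCombination ℝ fun x : X => RKHS.kerFun H x (1 : ℝ)) := by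
    rw [Submodule.span_le]
    rintro _ ⟨x, v, rfl⟩
    refine ⟨Finsupp.single x v, ?_⟩
    rw [Finsupp.linearCombination_single, ← map_smul, smul_eq_mul, mul_one]
  have h2 : Dense ((Submodule.span ℝ {RKHS.kerFun H x v | (x : X) (v : ℝ)} : Submodule ℝ H) :
      Set H) := Submodule.dense_iff_topologicalClosure_eq_top.2 (RKHS.kerFun_dense H)
  exact h2.mono h1

/-- The functions of the reproducing kernel Hilbert space are Fourier transforms of square
integrable densities with respect to the spectral measure. -/
theorem exists_spectral_density (hα : IsSpectralMeasure α k)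
    (hH : IsRKHSOfTranslationKernel X k H) (f : H) :
    ∃ g : EuclideanSpace ℝ (Fin d) → ℂ, Measurable g ∧ MemLp g 2 α ∧
      ∀ x : X, (f x : ℂ) = ∫ t, g t * planeWave x t ∂α := by
  have := hα.1
  set S := Finsupp.linearCombination ℝ fun x : X => RKHS.kerFun H x (1 : ℝ) with hS
  let e : X → Lp ℂ 2 α := fun x => (memLp_planeWave α (x : EuclideanSpace ℝ (Fin d))).toLp
  set Φ := Finsupp.linearCombination ℝ e with hΦ
  -- Both families have the Gram matrix k(x − y), so equality holds; the extension only needs the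
  -- inequality.
  have hnorm : ∀ c, ‖Φ c‖ ≤ 1 * ‖S c‖ := fun c => by
    rw [one_mul, ← sq_le_sq₀ (norm_nonneg _) (norm_nonneg _), ← real_inner_self_eq_norm_sq,
      ← real_inner_self_eq_norm_sq]
    refine le_of_eq ?_
    simp only [hS, hΦ, Finsupp.linearCombination_apply, Finsupp.sum_inner, Finsupp.inner_sum,
      inner_smul_left, inner_smul_right]
    simp only [e, real_inner_toLp_planeWave hα, inner_kerFun_kerFun hH]
  have hdense : DenseRange S := denseRange_linearCombination_kerFun X H
  let W := Φ.extendOfNorm S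
  have hW : ∀ c, W (S c) = Φ c := LinearMap.extendOfNorm_eq hdense ⟨1, hnorm⟩
  have hrep : ∀ (x : X) (f : H), (f x : ℂ) = inner ℂ (W f) (e x) := fun x f => by
    refine congrFun (hdense.equalizer
      (Complex.continuous_ofReal.comp (RKHS.continuous_eval x))
      (W.continuous.inner continuous_const) (funext fun c => ?_)) f
    simp only [Function.comp_apply, hW]
    induction c using Finsupp.induction_linear with
    | zero => simp
    | add a b ha hb =>
      rw [map_add, map_add, RKHS.coe_add, Pi.add_apply, Complex.ofReal_add, ha, hb,
        inner_add_left]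
    | single y r =>
      rw [hS, hΦ, Finsupp.linearCombination_single, Finsupp.linearCombination_single,
        RKHS.coe_smul, Pi.smul_apply, RKHS.kerFun_apply, hH x y,
        RCLike.real_smul_eq_coe_smul (K := ℂ) r (e y), inner_smul_left, inner_toLp_planeWave hα]
      simp
  -- The conjugate appears because the inner product is conjugate-linear in its first argument.
  refine ⟨fun t => starRingEnd ℂ (W f t), ?_, ?_, fun x => ?_⟩
  · exact Complex.continuous_conj.measurable.comp (Lp.stronglyMeasurable _).measurable
  · exact (Lp.memLp (W f)).of_le
      (Complex.continuous_conj.comp_aestronglyMeasurable (Lp.aestronglyMeasurable _))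
      (Eventually.of_forall fun t => by rw [RCLike.norm_conj])
  · rw [hrep, L2.inner_def]
    refine integral_congr_ae ?_
    filter_upwards [(memLp_planeWave α (x : EuclideanSpace ℝ (Fin d))).coeFn_toLp] with t ht
    rw [ht, RCLike.inner_apply, mul_comm]

end PlaneWave

/-! ### Differentiating a Fourier transform along one direction -/

section Derivative

variable {Ω : Type*} [MeasurableSpace Ω] {α : Measure Ω} {τ : Ω → ℝ}

theorem hasDerivAt_integral_mul_exp (hτ : Measurable τ) {G : Ω → ℂ} (hG : Integrable G α)
    (hG1 : Integrable (fun ω => G ω * (τ ω : ℂ)) α) (s : ℝ) :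
    HasDerivAt (fun s : ℝ => ∫ ω, G ω * Complex.exp (Complex.I * (τ ω * s : ℝ)) ∂α)
      (Complex.I * ∫ ω, G ω * (τ ω : ℂ) * Complex.exp (Complex.I * (τ ω * s : ℝ)) ∂α) s := by
  have hm : ∀ s : ℝ, Measurable fun ω => Complex.exp (Complex.I * (τ ω * s : ℝ)) := fun s => by
    fun_prop
  have h := (hasDerivAt_integral_of_dominated_loc_of_deriv_le (μ := α) (s := Set.univ) (x₀ := s)
    (F := fun (s : ℝ) ω => G ω * Complex.exp (Complex.I * (τ ω * s : ℝ)))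
    (F' := fun (s : ℝ) ω => Complex.I * (G ω * (τ ω : ℂ) * Complex.exp (Complex.I * (τ ω * s : ℝ))))
    (bound := fun ω => ‖G ω * (τ ω : ℂ)‖) univ_mem
    (Eventually.of_forall fun s => hG.1.mul (hm s).aestronglyMeasurable)
    (hG.mul_bdd (c := 1) (hm s).aestronglyMeasurable
      (Eventually.of_forall fun ω => (Complex.norm_exp_I_mul_ofReal _).le))
    ((hG1.1.mul (hm s).aestronglyMeasurable).const_mul _)
    (Eventually.of_forall fun ω s _ => by
      rw [norm_mul, norm_mul, Complex.norm_exp_I_mul_ofReal, Complex.norm_I, one_mul, mul_one])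
    hG1.norm
    (Eventually.of_forall fun ω s _ => by
      have h1 : HasDerivAt (fun s : ℝ => Complex.I * ((τ ω * s : ℝ) : ℂ))
          (Complex.I * ((τ ω * 1 : ℝ) : ℂ)) s :=
        (((hasDerivAt_id s).const_mul (τ ω)).ofReal_comp).const_mul _
      refine (h1.cexp.const_mul (G ω)).congr_deriv ?_
      push_cast
      ring)).2
  rwa [integral_const_mul] at h

/-- If the Fourier transform of `G` along `τ` is a polynomial near the origin, then `G` is
orthogonal to the powers of `τ` of an exponent above the degree. -/
theorem integral_mul_pow_eq_zero_of_eventually_eq (hτ : Measurable τ) {G : Ω → ℂ}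
    (hG : ∀ n : ℕ, Integrable (fun ω => G ω * (τ ω : ℂ) ^ n) α) (q : Polynomial ℂ)
    (hq : ∀ᶠ s : ℝ in 𝓝 0,
      ∫ ω, G ω * Complex.exp (Complex.I * (τ ω * s : ℝ)) ∂α = q.eval (s : ℂ))
    {n : ℕ} (hn : q.natDegree < n) : ∫ ω, G ω * (τ ω : ℂ) ^ n ∂α = 0 := by
  have key : ∀ n : ℕ, ∀ᶠ s : ℝ in 𝓝 0,
      Complex.I ^ n * ∫ ω, G ω * (τ ω : ℂ) ^ n * Complex.exp (Complex.I * (τ ω * s : ℝ)) ∂α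
        = (Polynomial.derivative^[n] q).eval (s : ℂ) := by
    intro n
    induction n with
    | zero => simpa using hq
    | succ n ih =>
      -- The identity is kept on a neighbourhood of 0 rather than at 0, so that it can be
      -- differentiated again.
      filter_upwards [ih.eventually_nhds] with s hs
      have h1 := (hasDerivAt_integral_mul_exp hτ (hG n) (by
        simpa only [pow_succ, mul_assoc] using hG (n + 1)) s).const_mul (Complex.I ^ n)
      have h2 : HasDerivAt (fun s : ℝ => (Polynomial.derivative^[n] q).eval (s : ℂ))
          ((Polynomial.derivative (Polynomial.derivative^[n] q)).eval (s : ℂ)) s :=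
        (Polynomial.hasDerivAt _ _).comp_ofReal
      rw [Function.iterate_succ_apply', h2.unique (h1.congr_of_eventuallyEq (hs.mono
        fun _ h => h.symm))]
      simp only [pow_succ, mul_assoc]
  have h := (key n).self_of_nhds
  rw [Polynomial.iterate_derivative_eq_zero hn] at h
  simpa using h

end Derivative

/-! ### Polynomials on open sets -/

section Polynomials

variable {d : ℕ}

theorem MvPolynomial.exists_eval_line (p : MvPolynomial (Fin d) ℝ) (x v : Fin d → ℝ) :
    ∃ q : Polynomial ℝ, ∀ s, q.eval s = MvPolynomial.eval (fun j => x j + s * v j) p := by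
  refine ⟨MvPolynomial.aeval
    (fun j => Polynomial.C (x j) + Polynomial.X * Polynomial.C (v j)) p, fun s => ?_⟩
  induction p using MvPolynomial.induction_on with
  | C a => simp
  | add p q hp hq => simp only [map_add, Polynomial.eval_add, hp, hq]
  | mul_X p j hp =>
    simp only [map_mul, Polynomial.eval_mul, hp, MvPolynomial.aeval_X, MvPolynomial.eval_X,
      Polynomial.eval_add, Polynomial.eval_C, Polynomial.eval_X]

theorem exists_pi_ball_subset {V : Set (EuclideanSpace ℝ (Fin d))} (hV : IsOpen V)
    {x : EuclideanSpace ℝ (Fin d)} (hx : x ∈ V) :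
    ∃ ε > 0, ∀ y : Fin d → ℝ, (∀ j, y j ∈ Metric.ball (x j) ε) → WithLp.toLp 2 y ∈ V := by
  have hV' : IsOpen ((fun y : Fin d → ℝ => WithLp.toLp 2 y) ⁻¹' V) :=
    hV.preimage (PiLp.continuous_toLp 2 _)
  obtain ⟨ε, hε, h⟩ := Metric.isOpen_iff.1 hV' (fun j => x j) hx
  refine ⟨ε, hε, fun y hy => h ?_⟩
  rw [Metric.mem_ball, dist_pi_lt_iff hε]
  exact hy

theorem Real.infinite_ball (x : ℝ) {ε : ℝ} (hε : 0 < ε) : (Metric.ball x ε).Infinite := by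
  rw [Real.ball_eq_Ioo]
  exact Set.Ioo_infinite (by linarith)

theorem MvPolynomial.eq_zero_of_eval_eq_zero_on_open {p : MvPolynomial (Fin d) ℝ}
    {V : Set (EuclideanSpace ℝ (Fin d))} (hV : IsOpen V) (hne : V.Nonempty)
    (h : ∀ x ∈ V, MvPolynomial.eval (fun j => x j) p = 0) : p = 0 := by
  obtain ⟨x, hx⟩ := hne
  obtain ⟨ε, hε, hball⟩ := exists_pi_ball_subset hV hx
  refine MvPolynomial.funext_set (fun j => Metric.ball (x j) ε)
    (fun j => Real.infinite_ball _ hε) fun y hy => ?_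
  rw [map_zero]
  exact h _ (hball y fun j => hy j (Set.mem_univ j))

/-- A polynomial whose values on an open set do not depend on the `i`-th coordinate does not
contain the `i`-th variable. -/
theorem MvPolynomial.degreeOf_eq_zero_of_eval_eq_on_open {p : MvPolynomial (Fin d) ℝ} {i : Fin d}
    {V : Set (EuclideanSpace ℝ (Fin d))} (hV : IsOpen V) (hne : V.Nonempty)
    (h : ∀ x ∈ V, ∀ y ∈ V, (∀ j, j ≠ i → x j = y j) →
      MvPolynomial.eval (fun j => x j) p = MvPolynomial.eval (fun j => y j) p) :
    p.degreeOf i = 0 := by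
  obtain ⟨x, hx⟩ := hne
  obtain ⟨ε, hε, hball⟩ := exists_pi_ball_subset hV hx
  -- Freezing the i-th variable at `x i` leaves `p` unchanged on a box, hence identically, and the
  -- substituted polynomial has no i-th variable.
  set σ : Fin d → MvPolynomial (Fin d) ℝ :=
    Function.update MvPolynomial.X i (MvPolynomial.C (x i)) with hσ
  have hp : p = MvPolynomial.bind₁ σ p := by
    refine MvPolynomial.funext_set (fun j => Metric.ball (x j) ε)
      (fun j => Real.infinite_ball _ hε) fun y hy => ?_
    have hy' : ∀ j, y j ∈ Metric.ball (x j) ε := fun j => hy j (Set.mem_univ j)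
    have e : ∀ j, MvPolynomial.eval y (σ j) = Function.update y i (x i) j := fun j => by
      rcases eq_or_ne j i with rfl | hj
      · simp [hσ]
      · simp [hσ, hj]
    have h1 := h _ (hball y hy') _ (hball (Function.update y i (x i)) fun j => by
      rcases eq_or_ne j i with rfl | hj
      · simpa using hε
      · simpa [hj] using hy' j) fun j hj => by simp [hj]
    rw [MvPolynomial.eval, MvPolynomial.eval₂Hom_bind₁]
    change MvPolynomial.eval y p = MvPolynomial.eval (fun j => MvPolynomial.eval y (σ j)) p
    simp only [e]
    exact h1
  by_contra hdeg
  rw [← ne_eq, ← MvPolynomial.mem_vars_iff_degreeOf_ne_zero, hp] at hdeg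
  have := MvPolynomial.vars_bind₁ σ p hdeg
  rw [Finset.mem_biUnion] at this
  obtain ⟨j, -, hj⟩ := this
  rcases eq_or_ne j i with rfl | hji
  · simp [hσ] at hj
  · simp [hσ, hji] at hj
    exact hji hj.symm

/-- On the line through 0 and `x` the polynomial is a bounded univariate one, hence constant. -/
theorem MvPolynomial.eval_eq_eval_zero_of_bounded (p : MvPolynomial (Fin d) ℝ) {M : ℝ}
    (h : ∀ x : EuclideanSpace ℝ (Fin d), |MvPolynomial.eval (fun j => x j) p| ≤ M)
    (x : EuclideanSpace ℝ (Fin d)) :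
    MvPolynomial.eval (fun j => x j) p = MvPolynomial.eval 0 p := by
  obtain ⟨q, hq⟩ := p.exists_eval_line 0 (fun j => x j)
  have hdeg : q.degree ≤ 0 := (Polynomial.isBoundedUnder_abs_atTop_iff q).1
    (isBoundedUnder_of ⟨M, fun s => by
      rw [hq]
      exact h (WithLp.toLp 2 fun j => (0 : Fin d → ℝ) j + s * x j)⟩)
  have h0 := hq 0
  have h1 := hq 1
  rw [Polynomial.eq_C_of_degree_le_zero hdeg, Polynomial.eval_C] at h0 h1
  simp only [Pi.zero_apply, zero_add, one_mul, zero_mul] at h0 h1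
  exact h1.symm.trans h0

end Polynomials

/-! ### Localisation of the spectral density on hyperplanes -/

section Spectral

variable {d : ℕ} {α : Measure (EuclideanSpace ℝ (Fin d))}

theorem measurable_coord (i : Fin d) : Measurable fun t : EuclideanSpace ℝ (Fin d) => t i := by
  fun_prop

/-- If a polynomial is represented on an open set by a square integrable spectral density, then
only the part of the density on the hyperplane `t i = 0` contributes. -/
theorem eval_eq_setIntegral_planeWave [IsFiniteMeasure α] {i : Fin d}
    (hdet : ∀ m : ℕ, HamburgerDeterminate (evenPowerWeighted (marginal α i) m))
    {g : EuclideanSpace ℝ (Fin d) → ℂ} (hgm : Measurable g) (hg : MemLp g 2 α)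
    {V : Set (EuclideanSpace ℝ (Fin d))} (hV : IsOpen V) {p : MvPolynomial (Fin d) ℝ}
    (hp : ∀ x ∈ V, (MvPolynomial.eval (fun j => x j) p : ℂ) = ∫ t, g t * planeWave x t ∂α)
    {x : EuclideanSpace ℝ (Fin d)} (hx : x ∈ V) :
    (MvPolynomial.eval (fun j => x j) p : ℂ)
      = ∫ t in {t | t i = 0}, g t * planeWave x t ∂α := by
  have hτ := measurable_coord i
  have hmom : ∀ n : ℕ, Integrable (fun t : EuclideanSpace ℝ (Fin d) => t i ^ n) α := fun n => by
    have h := (hdet 0).1 n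
    rw [evenPowerWeighted_zero, marginal,
      integrable_map_measure (by fun_prop) hτ.aemeasurable] at h
    exact h
  have hG : MemLp (fun t => g t * planeWave x t) 2 α := memLp_mul_planeWave hg x
  obtain ⟨q, hq⟩ := p.exists_eval_line (fun j => x j) (fun j => EuclideanSpace.single i (1 : ℝ) j)
  have hcont : Continuous fun s : ℝ => x + EuclideanSpace.single i s := by
    have : (fun s : ℝ => x + EuclideanSpace.single i s)
        = fun s : ℝ => x + s • EuclideanSpace.single i (1 : ℝ) := by
      ext s j; simp
    rw [this]; fun_prop
  have hev : ∀ᶠ s : ℝ in 𝓝 0, x + EuclideanSpace.single i s ∈ V :=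
    hcont.continuousAt.eventually_mem (hV.mem_nhds (by
      have : EuclideanSpace.single i (0 : ℝ) = 0 := by ext j; simp
      rwa [this, add_zero]))
  -- The weight exponent natDegree + 1 puts every power m + n strictly above the degree of the
  -- restriction to the line.
  have hzero := setIntegral_ne_zero_eq_zero hτ hmom (hdet (q.natDegree + 1))
    (hgm.mul (measurable_planeWave x)) hG fun n =>
      integral_mul_pow_eq_zero_of_eventually_eq hτ (integrable_mul_pow hτ hmom hG)
        (q.map Complex.ofRealHom) (by
          filter_upwards [hev] with s hs
          rw [← Complex.ofRealHom_eq_coe s, Polynomial.eval_map_apply, Complex.ofRealHom_eq_coe, hq]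
          have h1 := hp _ hs
          simp only [planeWave_add, planeWave_single, ← mul_assoc] at h1
          rw [← h1]
          congr 3
          ext j
          simp) (by
        have := Polynomial.natDegree_map_le (f := Complex.ofRealHom) (p := q)
        omega)
  have hms : MeasurableSet {t : EuclideanSpace ℝ (Fin d) | t i = 0} :=
    hτ (measurableSet_singleton 0)
  rw [hp x hx, ← integral_add_compl hms (hG.integrable one_le_two)]
  exact (congrArg _ hzero).trans (add_zero _)

theorem abs_add_cos_le_one (a : ℝ) :
    |(2 + Real.cos a + Real.cos (√2 * a)) / 4| ≤ 1 := by
  have h1 := Real.cos_le_one a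
  have h2 := Real.cos_le_one (√2 * a)
  have h3 := Real.neg_one_le_cos a
  have h4 := Real.neg_one_le_cos (√2 * a)
  exact abs_le.2 ⟨by linarith, by linarith⟩

/-- Both cosines equal 1 only if a and √2·a are multiples of 2π, which irrationality of √2 excludes
for a ≠ 0. Powers of this average thus converge to the indicator of 0. -/
theorem abs_add_cos_lt_one {a : ℝ} (ha : a ≠ 0) :
    |(2 + Real.cos a + Real.cos (√2 * a)) / 4| < 1 := by
  have h1 := Real.cos_le_one a
  have h2 := Real.cos_le_one (√2 * a)
  have h3 := Real.neg_one_le_cos a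
  have h4 := Real.neg_one_le_cos (√2 * a)
  refine abs_lt.2 ⟨by linarith, ?_⟩
  by_contra! hcon
  obtain ⟨n, hn⟩ := (Real.cos_eq_one_iff a).1 (by linarith)
  obtain ⟨l, hl⟩ := (Real.cos_eq_one_iff (√2 * a)).1 (by linarith)
  have hpi := Real.pi_pos
  have hn0 : (n : ℝ) ≠ 0 := fun h0 => ha (by rw [← hn, h0, zero_mul])
  refine irrational_sqrt_two ⟨(l : ℚ) / n, ?_⟩
  push_cast
  rw [div_eq_iff hn0]
  rw [← hn] at hl
  have : ((l : ℝ) - √2 * n) * (2 * Real.pi) = 0 := by linear_combination hl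
  rcases mul_eq_zero.1 this with h | h
  · linarith
  · linarith

/-- A density with constant Fourier transform keeps its transform when it is restricted to a
coordinate hyperplane. -/
theorem integral_indicator_mul_planeWave {g : EuclideanSpace ℝ (Fin d) → ℂ} (hg : Integrable g α)
    {c : ℂ} (h : ∀ x, ∫ t, g t * planeWave x t ∂α = c) (j : Fin d)
    (x : EuclideanSpace ℝ (Fin d)) :
    ∫ t, {t | t j = 0}.indicator g t * planeWave x t ∂α = c := by
  set Q : EuclideanSpace ℝ (Fin d) → ℝ :=
    fun t => (2 + Real.cos (t j) + Real.cos (√2 * t j)) / 4 with hQ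
  have hQm : Measurable Q := by fun_prop
  have hint : ∀ (n : ℕ) x, Integrable (fun t => g t * (Q t : ℂ) ^ n * planeWave x t) α := by
    intro n x
    refine integrable_mul_planeWave (hg.mul_bdd (c := 1) (by fun_prop)
      (Eventually.of_forall fun t => ?_)) x
    rw [norm_pow, Complex.norm_real]
    exact pow_le_one₀ (norm_nonneg _) (abs_add_cos_le_one _)
  -- Multiplying the density by `Q` averages translates of its transform with weights 1/2 + 4 · 1/8
  -- = 1, so a constant transform is preserved.
  have hQe : ∀ x t, (Q t : ℂ) * planeWave x t = 1 / 2 * planeWave x t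
      + 1 / 8 * planeWave (x + EuclideanSpace.single j 1) t
      + 1 / 8 * planeWave (x + EuclideanSpace.single j (-1)) t
      + 1 / 8 * planeWave (x + EuclideanSpace.single j √2) t
      + 1 / 8 * planeWave (x + EuclideanSpace.single j (-√2)) t := by
    intro x t
    simp only [planeWave_add, planeWave_single, hQ]
    push_cast
    rw [Complex.cos, Complex.cos]
    have e1 : Complex.I * ((t j : ℂ) * 1) = t j * Complex.I := by ring
    have e2 : Complex.I * ((t j : ℂ) * -1) = -t j * Complex.I := by ring
    have e3 : Complex.I * ((t j : ℂ) * (√2 : ℝ)) = (√2 : ℝ) * t j * Complex.I := by ring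
    have e4 : Complex.I * ((t j : ℂ) * -(√2 : ℝ)) = -((√2 : ℝ) * t j) * Complex.I := by ring
    rw [e1, e2, e3, e4]
    ring
  have hpow : ∀ (n : ℕ) x, ∫ t, g t * (Q t : ℂ) ^ n * planeWave x t ∂α = c := by
    intro n
    induction n with
    | zero => simpa using h
    | succ n ih =>
      intro x
      have e : ∀ t, g t * (Q t : ℂ) ^ (n + 1) * planeWave x t
          = 1 / 2 * (g t * (Q t : ℂ) ^ n * planeWave x t)
          + 1 / 8 * (g t * (Q t : ℂ) ^ n * planeWave (x + EuclideanSpace.single j 1) t)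
          + 1 / 8 * (g t * (Q t : ℂ) ^ n * planeWave (x + EuclideanSpace.single j (-1)) t)
          + 1 / 8 * (g t * (Q t : ℂ) ^ n * planeWave (x + EuclideanSpace.single j √2) t)
          + 1 / 8 * (g t * (Q t : ℂ) ^ n * planeWave (x + EuclideanSpace.single j (-√2)) t) :=
        fun t => by linear_combination g t * (Q t : ℂ) ^ n * hQe x t
      simp only [e]
      have i0 := (hint n x).const_mul (1 / 2)
      have i1 := (hint n (x + EuclideanSpace.single j 1)).const_mul (1 / 8)
      have i2 := (hint n (x + EuclideanSpace.single j (-1))).const_mul (1 / 8)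
      have i3 := (hint n (x + EuclideanSpace.single j √2)).const_mul (1 / 8)
      have i4 := (hint n (x + EuclideanSpace.single j (-√2))).const_mul (1 / 8)
      rw [integral_add (((i0.fun_add i1).fun_add i2).fun_add i3) i4, integral_add ((i0.fun_add i1).fun_add i2) i3,
        integral_add (i0.fun_add i1) i2, integral_add i0 i1]
      simp only [integral_const_mul, ih]
      ring
  have lim : Tendsto (fun n : ℕ => ∫ t, g t * (Q t : ℂ) ^ n * planeWave x t ∂α) atTop
      (𝓝 (∫ t, {t | t j = 0}.indicator g t * planeWave x t ∂α)) := by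
    refine tendsto_integral_of_dominated_convergence (fun t => ‖g t‖)
      (fun n => (hint n x).1) hg.norm (fun n => Eventually.of_forall fun t => ?_)
      (Eventually.of_forall fun t => ?_)
    · rw [norm_mul, norm_mul, norm_planeWave, mul_one, norm_pow, Complex.norm_real]
      exact mul_le_of_le_one_right (norm_nonneg _)
        (pow_le_one₀ (norm_nonneg _) (abs_add_cos_le_one _))
    · refine Tendsto.mul_const _ ?_
      by_cases ht : t j = 0
      · rw [Set.indicator_of_mem (by exact ht)]
        refine tendsto_const_nhds.congr fun n => ?_
        have : Q t = 1 := by simp only [hQ, ht, mul_zero, Real.cos_zero]; norm_num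
        simp [this]
      · rw [Set.indicator_of_notMem (by exact ht)]
        have : Tendsto (fun n : ℕ => (Q t : ℂ) ^ n) atTop (𝓝 0) :=
          tendsto_pow_atTop_nhds_zero_of_norm_lt_one (by
            rw [Complex.norm_real]; exact abs_add_cos_lt_one ht)
        simpa using this.const_mul (g t)
  simp only [hpow] at lim
  exact tendsto_nhds_unique lim tendsto_const_nhds

/-- The Fourier transform of an integrable density with respect to a measure without an atom at
the origin is not a non-zero constant. -/
theorem eq_zero_of_integral_planeWave_eq_const (h_zero : α {0} = 0)
    {g : EuclideanSpace ℝ (Fin d) → ℂ} (hg : Integrable g α)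
    {c : ℂ} (h : ∀ x, ∫ t, g t * planeWave x t ∂α = c) : c = 0 := by
  -- Cutting by one coordinate hyperplane at a time ends at the origin, which α does not charge.
  have key : ∀ S : Finset (Fin d), ∀ x,
      ∫ t, {t : EuclideanSpace ℝ (Fin d) | ∀ j ∈ S, t j = 0}.indicator g t * planeWave x t ∂α
        = c := by
    intro S
    induction S using Finset.induction_on with
    | empty => simpa using h
    | insert j S _ ih =>
      have hms : MeasurableSet {t : EuclideanSpace ℝ (Fin d) | ∀ j ∈ S, t j = 0} := by
        simp only [Set.ofPred_forall]
        exact S.measurableSet_biInter fun j _ => measurable_coord j (measurableSet_singleton 0)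
      have h1 := integral_indicator_mul_planeWave (hg.indicator hms) ih j
      have e : {t : EuclideanSpace ℝ (Fin d) | ∀ l ∈ insert j S, t l = 0}
          = {t | t j = 0} ∩ {t | ∀ l ∈ S, t l = 0} := by
        ext t; simp
      simpa only [e, ← Set.indicator_indicator] using h1
  rw [← key Finset.univ 0]
  have e : {t : EuclideanSpace ℝ (Fin d) | ∀ j ∈ Finset.univ, t j = 0} = {0} := by
    ext t
    simp only [Finset.mem_univ, true_imp_iff, Set.mem_singleton_iff]
    exact ⟨fun ht => by ext j; exact ht j, fun ht => by simp [ht]⟩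
  refine integral_eq_zero_of_ae ?_
  have hae : ∀ᵐ t ∂α, t ∉ ({0} : Set (EuclideanSpace ℝ (Fin d))) :=
    measure_eq_zero_iff_ae_notMem.1 h_zero
  filter_upwards [hae] with t ht
  rw [e, Set.indicator_of_notMem ht, zero_mul, Pi.zero_apply]

end Spectral

/-! ### The two exclusion statements -/

theorem mainTheorem8 {d : ℕ} (X : Set (EuclideanSpace ℝ (Fin d)))
    (hX : (interior X).Nonempty)
    (k : EuclideanSpace ℝ (Fin d) → ℝ) (α : Measure (EuclideanSpace ℝ (Fin d)))
    (hα : IsSpectralMeasure α k)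
    (H : Type*) [NormedAddCommGroup H] [InnerProductSpace ℝ H] [CompleteSpace H]
    [RKHS ℝ H X ℝ] (hH : IsRKHSOfTranslationKernel X k H)
    (h_zero : α {0} = 0)
    (i : Fin d)
    (hdet : ∀ m : ℕ, HamburgerDeterminate (evenPowerWeighted (marginal α i) m)) :
    ((marginal α i {0} = 0 ∨ X = Set.univ) →
      ∀ p : MvPolynomial (Fin d) ℝ, p ≠ 0 → ¬ PolynomialMem H p) ∧
    (∀ p : MvPolynomial (Fin d) ℝ, p.degreeOf i ≠ 0 → ¬ PolynomialMem H p) := by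
  have := hα.1
  have hrep : ∀ p : MvPolynomial (Fin d) ℝ, PolynomialMem H p →
      ∃ g : EuclideanSpace ℝ (Fin d) → ℂ, Measurable g ∧ MemLp g 2 α ∧
        ∀ x ∈ X, (MvPolynomial.eval (fun j => x j) p : ℂ) = ∫ t, g t * planeWave x t ∂α := by
    rintro p ⟨f, hf⟩
    obtain ⟨g, hgm, hg, h⟩ := exists_spectral_density hα hH f
    exact ⟨g, hgm, hg, fun x hx => by rw [← h ⟨x, hx⟩, hf]⟩
  have hplane : ∀ (p : MvPolynomial (Fin d) ℝ) (g : EuclideanSpace ℝ (Fin d) → ℂ), Measurable g →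
      MemLp g 2 α →
      (∀ x ∈ X, (MvPolynomial.eval (fun j => x j) p : ℂ) = ∫ t, g t * planeWave x t ∂α) →
      ∀ x ∈ interior X, (MvPolynomial.eval (fun j => x j) p : ℂ)
        = ∫ t in {t | t i = 0}, g t * planeWave x t ∂α := fun p g hgm hg h x hx =>
    eval_eq_setIntegral_planeWave hdet hgm hg isOpen_interior
      (fun y hy => h y (interior_subset hy)) hx
  refine ⟨fun hcase p hp0 hp => ?_, fun p hdeg hp => ?_⟩
  · obtain ⟨g, hgm, hg, h⟩ := hrep p hp
    rcases hcase with hmarg | rfl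
    · rw [marginal, Measure.map_apply (measurable_coord i) (measurableSet_singleton 0)] at hmarg
      have hplane0 : α {t | t i = 0} = 0 := hmarg
      refine hp0 (MvPolynomial.eq_zero_of_eval_eq_zero_on_open isOpen_interior hX fun x hx => ?_)
      have h1 := hplane p g hgm hg h x hx
      rw [setIntegral_measure_zero _ hplane0] at h1
      exact_mod_cast h1
    · have hgi : Integrable g α := hg.integrable one_le_two
      -- On the whole space the representation bounds the polynomial by the L¹ norm of `g`.
      have hconst := p.eval_eq_eval_zero_of_bounded (M := ∫ t, ‖g t‖ ∂α) fun x => by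
        rw [← Real.norm_eq_abs, ← Complex.norm_real, h x (Set.mem_univ x)]
        refine norm_integral_le_of_norm_le hgi.norm (Eventually.of_forall fun t => ?_)
        rw [norm_mul, norm_planeWave, mul_one]
      have hc := eq_zero_of_integral_planeWave_eq_const h_zero hgi
        (c := (MvPolynomial.eval 0 p : ℝ)) fun x => by rw [← h x (Set.mem_univ x), hconst]
      refine hp0 (MvPolynomial.eq_zero_of_eval_eq_zero_on_open isOpen_univ
        Set.univ_nonempty fun x _ => ?_)
      rw [hconst]
      exact_mod_cast hc
  · obtain ⟨g, hgm, hg, h⟩ := hrep p hp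
    refine hdeg (MvPolynomial.degreeOf_eq_zero_of_eval_eq_on_open isOpen_interior hX
      fun x hx y hy hxy => ?_)
    have h1 := hplane p g hgm hg h x hx
    rw [← Complex.ofReal_inj, h1, hplane p g hgm hg h y hy]
    -- On t_i = 0 the phase ⟨t, x⟩ does not involve x_i.
    refine setIntegral_congr_fun (measurable_coord i (measurableSet_singleton 0)) fun t ht => ?_
    have hti : t i = 0 := ht
    simp only [planeWave]
    congr 4
    refine Finset.sum_congr rfl fun j _ => ?_
    rcases eq_or_ne j i with rfl | hj
    · rw [hti, zero_mul, zero_mul]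
    · rw [hxy j hj]
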